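/- Let $k$ be an algebraically closed field and $A$ a finite-dimensional basic $k$-algebra; modules are finitely generated left modules and maps are composed from right to left. Let $(\Lambda,\leqslant)$ be a finite poset, and let $\underline\Theta=\{\Theta_\lambda\}_{\lambda\in\Lambda}$ be nonzero $A$-modules and $\underline Q=\{Q_\lambda\}_{\lambda\in\Lambda}$ indecomposable $A$-modules. Put $\Theta=\bigoplus_\lambda\Theta_\lambda$, $Q=\bigoplus_\lambda Q_\lambda$, let $\mathcal F(\Theta)$ be the class of modules having a finite filtration with all factors isomorphic to some $\Theta_\lambda$, let $\operatorname{add}(Q)$ be the class of direct summands of the modules $Q^{n}$, and write $\operatorname{top}M=M/\operatorname{rad}M$. Suppose that $(\underline\Theta,\underline Q)$ is an Ext-projective stratifying system (EPSS), that is: (i) $\operatorname{Hom}_A(\Theta_\lambda,\Theta_\mu)=0$ if $\lambda\nleqslant\mu$; (ii) for each $\lambda$ there is an exact sequence $0\to K_\lambda\to Q_\lambda\to\Theta_\lambda\to0$ such that $K_\lambda$ has a filtration with factors isomorphic to modules $\Theta_\mu$ with $\mu>\lambda$; (iii) $\operatorname{Ext}^1_A(Q_\lambda,M)=0$ for all $\lambda\in\Lambda$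 and $M\in\mathcal F(\Theta)$. Suppose moreover that $\operatorname{Ext}^s_A(Q,\Theta)=0$ for all $s\geqslant1$, that each $\Theta_\lambda$ has a simple top $S_\lambda$, and that $S_\lambda\ncong S_\mu$ for $\lambda\neq\mu$. Let $\Lambda_1$ be the set of minimal elements of $\Lambda$, $\Lambda_2$ the set of minimal elements of $\Lambda\setminus\Lambda_1$, and so on, and put $h(\lambda)=i$ for $\lambda\in\Lambda_i$. A module $M$ is generated in height $i$ if there is an exact sequence $0\to N\to M\to\bigoplus_{h(\lambda)=i}\Theta_\lambda^{m_\lambda}\to0$ such that $N$ has a filtration with factors isomorphic to modules $\Theta_\mu$ with $h(\mu)>i$, and $\operatorname{top}M\cong\operatorname{top}\bigl(\bigoplus_{h(\lambda)=i}\Theta_\lambda^{m_\lambda}\bigr)$ (in particular the zero module is generated in every height). A relative projective cover of $M\in\mathcal F(\Theta)$ is a surjection $p:P\to M$ with $P\in\operatorname{add}(Q)$ and $\operatorname{Ker}p\in\mathcal F(\Theta)$ such that every $g\in\operatorname{End}_A(P)$ with $pg=p$ is an automorphism; its kernel is the relative syzygy $\Omega_\Theta(M)$. A module $M\in\mathcal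 F(\Theta)$ is linearly filtered if there is some $i$ such that $\Omega_\Theta^s(M)$ is generated in height $i+s$ for all $s\geqslant0$. Suppose that all $\Theta_\lambda$ are linearly filtered and that $\operatorname{Hom}_A(Q,\Theta)\cong\operatorname{Hom}_A(\Theta,\Theta)$ as left $\operatorname{End}_A(\Theta)$-modules. Let $\Gamma=\operatorname{Ext}^*_A(\Theta,\Theta)=\bigoplus_{s\geqslant0}\operatorname{Ext}^s_A(\Theta,\Theta)$ with the Yoneda product, let $e_\lambda\in\Gamma$ be the degree $0$ idempotent given by the projection of $\Theta$ onto $\Theta_\lambda$, and let $P_\lambda=\Gamma e_\lambda=\operatorname{Ext}^*_A(\Theta_\lambda,\Theta)$. Then the following are equivalent: (a) $\Gamma$ is standardly stratified for $\leqslant$; that is, $\Gamma$ is finite-dimensional, $\{e_\lambda\}_{\lambda\in\Lambda}$ is a complete set of primitive orthogonal idempotents with $P_\lambda\ncong P_\mu$ for $\lambda\neq\mu$ (so that $\Lambda$ indexes the simple modules $\operatorname{top}P_\lambda$ of $\Gamma$), and there are $\Gamma$-modules $\Delta_\lambda$ and exact sequences $0\to K'_\lambda\to P_\lambda\to\Delta_\lambda\to0$,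 $\lambda\in\Lambda$, such that $[\Delta_\lambda:\operatorname{top}P_\mu]=0$ whenever $\mu\nleqslant\lambda$ and $K'_\lambda$ has a filtration with factors isomorphic to modules $\Delta_\mu$ with $\mu>\lambda$; (b) $\operatorname{End}_A(\Theta)$ is a projective left module over $\bigoplus_{\lambda\in\Lambda}\operatorname{End}_A(\Theta_\lambda)$, acting by postcomposition. -/

import Mathlib

universe u v

open CategoryTheory

namespace ExtStrat

/-! ### Modules: filtrations, radical quotients, composition factors -/

/-- `M` has a finite chain of submodules `0 = F 0 ≤ F 1 ≤ ... ≤ F n = M` such that the successive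
quotients are isomorphic to `X l₀, ..., X lₙ₋₁`, where `l = [l₀, ..., lₙ₋₁]`. -/
def HasFiltration (R : Type*) [Ring R] {ι : Type*} (X : ι → Type*)
    [∀ i, AddCommGroup (X i)] [∀ i, Module R (X i)]
    (M : Type*) [AddCommGroup M] [Module R M] (l : List ι) : Prop :=
  ∃ F : ℕ → Submodule R M, F 0 = ⊥ ∧ F l.length = ⊤ ∧
    ∀ (j : ℕ) (hj : j < l.length), F j ≤ F (j + 1) ∧
      Nonempty ((↥(F (j + 1)) ⧸ (F j).submoduleOf (F (j + 1))) ≃ₗ[R] X (l[j]'hj))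

/-- `M` has a finite filtration all of whose factors are isomorphic to some `X i` with `i ∈ S`. -/
def IsFilteredBy (R : Type*) [Ring R] {ι : Type*} (X : ι → Type*)
    [∀ i, AddCommGroup (X i)] [∀ i, Module R (X i)] (S : Set ι)
    (M : Type*) [AddCommGroup M] [Module R M] : Prop :=
  ∃ l : List ι, (∀ i ∈ l, i ∈ S) ∧ HasFiltration R X M l

/-- The module `M / rad M`, where `rad M` is the intersection of all maximal submodules
(only used for finitely generated modules over finite-dimensional algebras). -/
abbrev Head (R : Type*) [Ring R] (M : Type*) [AddCommGroup M] [Module R M] : Type _ :=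
  M ⧸ Module.jacobson R M

/-- Indecomposable modules (the zero module is not indecomposable). -/
def IsIndecomposable (R : Type*) [Ring R] (M : Type*) [AddCommGroup M] [Module R M] : Prop :=
  Nontrivial M ∧ ∀ N N' : Submodule R M, IsCompl N N' → N = ⊥ ∨ N' = ⊥

/-- The simple module `S` occurs as a composition factor of `M` (i.e. `[M : S] ≠ 0` when `M` has
finite length): it is isomorphic to a subquotient of `M`. -/
def IsCompositionFactor (R : Type*) [Ring R] (S : Type*) [AddCommGroup S] [Module R S]
    (M : Type*) [AddCommGroup M] [Module R M] : Prop :=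
  ∃ (N : Submodule R M) (N' : Submodule R ↥N), Nonempty ((↥N ⧸ N') ≃ₗ[R] S)

/-! ### Basic algebras and standardly stratified algebras -/

/-- `e` is a complete family of primitive orthogonal idempotents of `R` such that the left modules
`R e i` are pairwise non-isomorphic. -/
structure IsBasicFamily {R : Type*} [Ring R] {ι : Type*} [Fintype ι] (e : ι → R) : Prop where
  complete : CompleteOrthogonalIdempotents e
  ne_zero : ∀ i, e i ≠ 0
  primitive : ∀ i (f g : R), IsIdempotentElem f → IsIdempotentElem g → f * g = 0 → g * f = 0 →
    f + g = e i → f = 0 ∨ g = 0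
  not_iso : ∀ i j, i ≠ j → IsEmpty (↥(Ideal.span {e i}) ≃ₗ[R] ↥(Ideal.span {e j}))

/-- A finite-dimensional algebra is basic if it has a complete family of primitive orthogonal
idempotents generating pairwise non-isomorphic left ideals. -/
def IsBasic (R : Type*) [Ring R] : Prop :=
  ∃ (n : ℕ) (e : Fin n → R), IsBasicFamily e

/-- The finite-dimensional `k`-algebra `R`, whose indecomposable projective left modules are
represented by `P l = R e l` and whose simple modules are represented by `S l = P l / rad (P l)`,
is standardly stratified with respect to the poset `Λ`: there are quotient modules
`Δ l = P l / K l` such that all composition factors `S m` of `Δ l` satisfy `m ≤ l`, and `K l` has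
a filtration by modules `Δ m` with `m > l`. -/
structure IsStandardlyStratified (k : Type*) [Field k] {R : Type*} [Ring R] [Algebra k R]
    {Λ : Type*} [Fintype Λ] [PartialOrder Λ] (e : Λ → R) : Prop where
  finite : Module.Finite k R
  basic : IsBasicFamily e
  stratified : ∃ K : ∀ l : Λ, Submodule R ↥(Ideal.span {e l}),
    (∀ l m : Λ, ¬ m ≤ l →
      ¬ IsCompositionFactor R (Head R ↥(Ideal.span {e m})) (↥(Ideal.span {e l}) ⧸ K l)) ∧
    ∀ l : Λ, IsFilteredBy R (fun m : Λ => ↥(Ideal.span {e m}) ⧸ K m) {m | l < m} ↥(K l)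

/-! ### The extension algebra -/

section ExtAlgebra

variable {C : Type*} [Category* C] [Abelian C] [HasExt.{v} C]

/-- Yoneda product, with maps composed from right to left: `x * y` is first `y`, then `x`. -/
noncomputable instance extGMul (X : C) : GradedMonoid.GMul (fun n : ℕ => Abelian.Ext X X n) where
  mul {a b} x y := y.comp x (add_comm b a)

noncomputable instance extGOne (X : C) : GradedMonoid.GOne (fun n : ℕ => Abelian.Ext X X n) where
  one := Abelian.Ext.mk₀ (𝟙 X)

theorem ext_sigma_eq {X : C} {a b : ℕ} (h : a = b) (x : Abelian.Ext X X a)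
    (y : Abelian.Ext X X b) (hxy : x.comp (Abelian.Ext.mk₀ (𝟙 X)) (by omega) = y) :
    GradedMonoid.mk (A := fun n : ℕ => Abelian.Ext X X n) a x = GradedMonoid.mk b y := by
  subst h
  rw [← hxy, Abelian.Ext.comp_mk₀_id]

noncomputable instance extGSemiring (X : C) :
    DirectSum.GSemiring (fun n : ℕ => Abelian.Ext X X n) where
  mul x y := GradedMonoid.GMul.mul x y
  one := GradedMonoid.GOne.one
  mul_zero {_ j} a := Abelian.Ext.zero_comp (X := X) (n := j) a _ _
  zero_mul b := Abelian.Ext.comp_zero b _ _ _ _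
  mul_add a b c := Abelian.Ext.add_comp b c a _
  add_mul a b c := Abelian.Ext.comp_add c a b _
  one_mul := by
    rintro ⟨n, x⟩
    refine ext_sigma_eq (zero_add n) (x.comp (Abelian.Ext.mk₀ (𝟙 X)) (by omega)) x ?_
    rw [Abelian.Ext.comp_assoc (a₂₃ := 0) (h₂₃ := rfl) (h := by omega)]
    simp
  mul_one := by
    rintro ⟨n, x⟩
    refine ext_sigma_eq (add_zero n) ((Abelian.Ext.mk₀ (𝟙 X)).comp x (by omega)) x ?_
    rw [Abelian.Ext.comp_mk₀_id, Abelian.Ext.mk₀_id_comp]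
  mul_assoc := by
    rintro ⟨a, x⟩ ⟨b, y⟩ ⟨c, z⟩
    refine ext_sigma_eq (add_assoc a b c)
      (z.comp (y.comp x (add_comm b a)) (by omega))
      ((z.comp y (add_comm c b)).comp x (by omega)) ?_
    rw [Abelian.Ext.comp_assoc z y x (add_comm c b) (add_comm b a) (by omega),
      Abelian.Ext.comp_assoc z (y.comp x (add_comm b a)) (Abelian.Ext.mk₀ (𝟙 X)) (by omega)
        (add_zero _) (by omega), Abelian.Ext.comp_mk₀_id]
  natCast n := n • Abelian.Ext.mk₀ (𝟙 X)
  natCast_zero := zero_smul _ _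
  natCast_succ n := succ_nsmul _ n

noncomputable instance extGRing (X : C) : DirectSum.GRing (fun n : ℕ => Abelian.Ext X X n) where
  intCast n := n • Abelian.Ext.mk₀ (𝟙 X)
  intCast_ofNat n := natCast_zsmul _ n
  intCast_negSucc_ofNat n := negSucc_zsmul _ n

noncomputable instance extGAlgebra (k : Type*) [Field k] [Linear k C] (X : C) :
    DirectSum.GAlgebra k (fun n : ℕ => Abelian.Ext X X n) where
  toFun :=
    { toFun := fun r => r • Abelian.Ext.mk₀ (𝟙 X)
      map_zero' := zero_smul _ _
      map_add' := fun r s => add_smul r s _ }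
  map_one := one_smul _ _
  map_mul r s := by
    refine ext_sigma_eq (add_zero 0).symm ((r * s) • Abelian.Ext.mk₀ (𝟙 X))
      ((s • Abelian.Ext.mk₀ (𝟙 X)).comp (r • Abelian.Ext.mk₀ (𝟙 X)) (by omega)) ?_
    rw [Abelian.Ext.comp_smul, Abelian.Ext.smul_comp, Abelian.Ext.smul_comp, mul_smul]
  commutes := by
    rintro r ⟨n, x⟩
    refine ext_sigma_eq ((zero_add n).trans (add_zero n).symm)
      (x.comp (r • Abelian.Ext.mk₀ (𝟙 X)) (by omega))
      ((r • Abelian.Ext.mk₀ (𝟙 X)).comp x (by omega)) ?_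
    rw [Abelian.Ext.comp_smul, Abelian.Ext.smul_comp, Abelian.Ext.smul_comp,
      Abelian.Ext.comp_assoc x (Abelian.Ext.mk₀ (𝟙 X)) (Abelian.Ext.mk₀ (𝟙 X)) (by omega)
        (add_zero _) (by omega), Abelian.Ext.comp_mk₀_id, Abelian.Ext.comp_mk₀_id,
      Abelian.Ext.mk₀_id_comp]
  smul_def := by
    rintro r ⟨n, x⟩
    refine ext_sigma_eq (zero_add n).symm (r • x)
      (x.comp (r • Abelian.Ext.mk₀ (𝟙 X)) (by omega)) ?_
    rw [Abelian.Ext.smul_comp, Abelian.Ext.comp_smul]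

/-- The extension algebra `Ext*(X, X) = ⨁ₙ Extⁿ(X, X)`. -/
abbrev ExtAlgebra (X : C) : Type v := DirectSum ℕ (fun n => Abelian.Ext X X n)

end ExtAlgebra

/-! ### Ext-projective stratifying systems and linearly filtered modules -/

section Systems

/-- For a finite poset `Λ`, the union of the first `n` layers of `Λ`: the first layer consists of
the minimal elements of `Λ`, and the `(n+1)`-st layer consists of the minimal elements of the
complement of the first `n` layers. -/
def layers (Λ : Type*) [PartialOrder Λ] : ℕ → Set Λ
  | 0 => ∅
  | n + 1 => layers Λ n ∪ {l | Minimal (fun m => m ∉ layers Λ n) l}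

/-- The height of `l`: the index (starting from `1`) of the layer containing `l`. -/
noncomputable def height {Λ : Type*} [PartialOrder Λ] (l : Λ) : ℕ :=
  sInf {n : ℕ | l ∈ layers Λ n}

variable (A : Type u) [Ring A] {Λ : Type u} [Fintype Λ] [PartialOrder Λ]
  (Θ : Λ → Type u) [∀ l, AddCommGroup (Θ l)] [∀ l, Module A (Θ l)]
  (Q : Λ → Type u) [∀ l, AddCommGroup (Q l)] [∀ l, Module A (Q l)]

/-- `M` belongs to `F(Θ)`: it has a finite filtration with factors among the `Θ l`. -/
def InF (M : Type u) [AddCommGroup M] [Module A M] : Prop :=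
  IsFilteredBy A Θ Set.univ M

/-- Ext-projective stratifying systems of finitely generated modules. -/
structure IsEPSS : Prop where
  finite_Θ : ∀ l, Module.Finite A (Θ l)
  finite_Q : ∀ l, Module.Finite A (Q l)
  nontrivial_Θ : ∀ l, Nontrivial (Θ l)
  indecomposable_Q : ∀ l, IsIndecomposable A (Q l)
  hom_eq_zero : ∀ l m, ¬ l ≤ m → ∀ f : Θ l →ₗ[A] Θ m, f = 0
  exact : ∀ l, ∃ p : Q l →ₗ[A] Θ l, Function.Surjective p ∧
    IsFilteredBy A Θ {m | l < m} ↥(LinearMap.ker p)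
  ext_eq_zero : ∀ (M : Type u) [AddCommGroup M] [Module A M], InF A Θ M → ∀ l,
    Subsingleton (Abelian.Ext (ModuleCat.of A (Q l)) (ModuleCat.of A M) 1)

/-- `P` belongs to `add Q`: it is a direct summand of a finite direct sum of copies of
`Q = ⨁ Q l`. -/
def InAdd (P : Type u) [AddCommGroup P] [Module A P] : Prop :=
  ∃ (n : ℕ) (i : P →ₗ[A] (Fin n → ∀ l, Q l)) (r : (Fin n → ∀ l, Q l) →ₗ[A] P),
    r ∘ₗ i = LinearMap.id

/-- `p : P → M` is a relative projective cover: a surjection with `P ∈ add Q` and kernel in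
`F(Θ)` which is right minimal. -/
structure IsRelProjCover {P M : Type u} [AddCommGroup P] [Module A P] [AddCommGroup M]
    [Module A M] (p : P →ₗ[A] M) : Prop where
  inAdd : InAdd A Q P
  surjective : Function.Surjective p
  ker_inF : InF A Θ ↥(LinearMap.ker p)
  minimal : ∀ g : P →ₗ[A] P, p ∘ₗ g = p → Function.Bijective g

/-- `K` is (isomorphic to) the relative syzygy `Ω_Θ(M)`. -/
def IsRelSyzygy (M K : Type u) [AddCommGroup M] [Module A M] [AddCommGroup K] [Module A K] :
    Prop :=
  ∃ (P : ModuleCat.{u} A) (p : P →ₗ[A] M), IsRelProjCover A Θ Q p ∧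
    Nonempty (K ≃ₗ[A] ↥(LinearMap.ker p))

/-- `M ∈ F(Θ)` is generated in height `i`: there is an exact sequence
`0 → N → M → ⨁_{h(l) = i} (Θ l)^(m l) → 0` where `N` is filtered by modules `Θ l` with
`h(l) > i`, and `M` and `⨁_{h(l) = i} (Θ l)^(m l)` have isomorphic heads. The zero module is
generated in every height; a nonzero `M` can only be generated in the height
`min M = min {h(l) | l ∈ supp M}`. -/
def IsGeneratedInHeight (i : ℕ) (M : Type u) [AddCommGroup M] [Module A M] : Prop :=
  ∃ (N : Submodule A M) (m : Λ → ℕ),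
    IsFilteredBy A Θ {l | i < height l} ↥N ∧
    Nonempty ((M ⧸ N) ≃ₗ[A] (∀ l : {l : Λ // height l = i}, Fin (m l) → Θ l)) ∧
    Nonempty (Head A M ≃ₗ[A] Head A (∀ l : {l : Λ // height l = i}, Fin (m l) → Θ l))

/-- `M ∈ F(Θ)` is linearly filtered: for some `i`, every relative syzygy `K s = Ω_Θ^s(M)` is
generated in height `i + s`. -/
def IsLinearlyFiltered (M : Type u) [AddCommGroup M] [Module A M] : Prop :=
  InF A Θ M ∧ ∃ (i : ℕ) (K : ℕ → ModuleCat.{u} A), Nonempty (K 0 ≃ₗ[A] M) ∧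
    (∀ s, IsRelSyzygy A Θ Q (K s) (K (s + 1))) ∧
    ∀ s, IsGeneratedInHeight A Θ (i + s) (K s)

open Classical in
/-- The idempotent of degree `0` in `Ext*(Θ, Θ)`, `Θ = ⨁ Θ l`, given by the projection of `Θ`
onto its summand `Θ l`. The left ideal generated by it is `Ext*(Θ l, Θ)`. -/
noncomputable def extIdem (l : Λ) : ExtAlgebra (ModuleCat.of A (∀ l, Θ l)) :=
  DirectSum.of (fun n : ℕ => Abelian.Ext (ModuleCat.of A (∀ l, Θ l)) (ModuleCat.of A (∀ l, Θ l)) n)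
    0 (Abelian.Ext.mk₀ (ModuleCat.ofHom (LinearMap.single A Θ l ∘ₗ LinearMap.proj l)))

/-- The diagonal embedding of algebras `⨁ End(Θ l) → End(Θ)`, `Θ = ⨁ Θ l`. -/
def diagEnd : (∀ l, Module.End A (Θ l)) →+* Module.End A (∀ l, Θ l) where
  toFun f := LinearMap.pi fun l => f l ∘ₗ LinearMap.proj l
  map_one' := rfl
  map_mul' _ _ := rfl
  map_zero' := rfl
  map_add' _ _ := rfl

/-- `End(Θ)` is a projective module over `⨁ End(Θ l)`, acting by postcomposition. -/
def EndIsProjective : Prop :=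
  letI : Module (∀ l, Module.End A (Θ l)) (Module.End A (∀ l, Θ l)) :=
    Module.compHom (Module.End A (∀ l, Θ l)) (diagEnd A Θ)
  Module.Projective (∀ l, Module.End A (Θ l)) (Module.End A (∀ l, Θ l))

end Systems

end ExtStrat

/-! Write `D` for the product of the rings `End(Θ l)` and `Γ` for `Ext*(Θ, Θ)`. The plan is to show
that both (a) and (b) amount to projectivity of `Γ` over `D`.

Triangularity (`IsEPSS.subsingleton_ext`, `isTriangular_extAlgebra`). Shifting along `0 → K l → Q l
→ Θ l → 0`, with `Ext^s(Q, Θ) = 0` for `s ≥ 1`, gives `Ext^n(Θ l, Θ m) = 0` unless `l ≤ m`, and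
unless `l < m` when `n ≥ 1`. Hence `e l * Γ * e l = End(Θ l)`, which is a local ring because `Θ l`
has a simple top, and `e m * Γ * e l = 0` unless `l ≤ m`.

Stratification (`IsTriangular`). In such a ring the only possible `Δ l` is `Γ e l` modulo its
off-diagonal part, a copy of `End(Θ l)` supported at `e l` and projective over `D`. A stratification
therefore makes `Γ` an iterated extension of `D`-projectives. Conversely, if `Γ` is `D`-projective,
so is the off-diagonal part of `Γ e l`, and copies of the modules `Δ m` are split off from it over
`D`, starting each time from an index `m` that is maximal in the support.

Degree zero controls all degrees (`IsEPSS.isExtFinProj_syzygy`). The isomorphism `Hom(Q, Θ) ≅ Hom(Θ,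
Θ)` forces every map `Q l → Θ` to factor through `Θ l`. So if `M` is generated in one height, each
map `M → Θ` factors through its top layer of `Θ`'s, and each map from its relative projective cover
to `Θ` kills the syzygy. For linearly filtered `Θ l` this yields `Ext^n(Θ l, Θ) ≅ Hom(Ω^n Θ l, Θ)`,
which is the `Hom` into `Θ` from a finite sum of `Θ`'s: finitely generated projective over `D` as
soon as `End(Θ)` is projective. Heights are bounded, so only finitely many degrees survive. In the
other direction `End(Θ)` is the degree zero summand of `Γ`. -/

namespace ExtStrat

/-! ### Filtrations by a family of modules -/

section Filtration

variable {R : Type*} [Ring R] {ι : Type*} {X : ι → Type*}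
    [∀ i, AddCommGroup (X i)] [∀ i, Module R (X i)]

/-- The subquotient of two nested submodules is invariant under a linear equivalence. -/
noncomputable def subquotientEquiv {M M' : Type*} [AddCommGroup M] [Module R M] [AddCommGroup M']
    [Module R M'] (f : M →ₗ[R] M') (hf : Function.Injective f) (N N' : Submodule R M) :
    (↥N' ⧸ N.submoduleOf N') ≃ₗ[R] (↥(N'.map f) ⧸ (N.map f).submoduleOf (N'.map f)) :=
  Submodule.Quotient.equiv _ _ (Submodule.equivMapOfInjective f hf N') (by
    ext ⟨y, hy⟩
    obtain ⟨x, hx, rfl⟩ := hy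
    constructor
    · rintro ⟨z, hz, hz'⟩
      have hz2 : f z = f x := congrArg Subtype.val hz'
      have : (z : M) = x := hf hz2
      exact ⟨x, this ▸ hz, rfl⟩
    · rintro ⟨z, hz, hz'⟩
      have : z = x := hf hz'
      subst this
      exact ⟨⟨z, hx⟩, hz, rfl⟩)

/-- The subquotient `⊤ / N` is the quotient by `N`. -/
noncomputable def topQuotientEquiv {M : Type*} [AddCommGroup M] [Module R M]
    (N T : Submodule R M) (hT : T = ⊤) : (↥T ⧸ N.submoduleOf T) ≃ₗ[R] (M ⧸ N) :=
  Submodule.Quotient.equiv _ _ (LinearEquiv.ofTop T hT) (by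
    ext y
    constructor
    · rintro ⟨z, hz, rfl⟩
      exact hz
    · intro hy
      exact ⟨⟨y, hT ▸ Submodule.mem_top⟩, hy, rfl⟩)

theorem HasFiltration.of_equiv {M M' : Type*} [AddCommGroup M] [Module R M] [AddCommGroup M']
    [Module R M'] (e : M ≃ₗ[R] M') {l : List ι} (h : HasFiltration R X M l) :
    HasFiltration R X M' l := by
  obtain ⟨F, h0, h1, h2⟩ := h
  refine ⟨fun j => (F j).map e.toLinearMap, by simp [h0], by simp [h1], fun j hj => ?_⟩
  obtain ⟨hle, ⟨e'⟩⟩ := h2 j hj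
  exact ⟨Submodule.map_mono hle,
    ⟨(subquotientEquiv e.toLinearMap e.injective (F j) (F (j + 1))).symm.trans e'⟩⟩

theorem hasFiltration_nil_iff {M : Type*} [AddCommGroup M] [Module R M] :
    HasFiltration R X M [] ↔ Subsingleton M := by
  constructor
  · rintro ⟨F, h0, h1, -⟩
    simp only [List.length_nil] at h1
    exact (Submodule.subsingleton_iff R).1 (subsingleton_of_bot_eq_top (h0.symm.trans h1))
  · intro h
    exact ⟨fun _ => ⊥, rfl, Subsingleton.elim _ _, fun j hj => absurd hj (by simp)⟩

theorem HasFiltration.append_singleton {M : Type*} [AddCommGroup M] [Module R M] {l : List ι}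
    {i : ι} (N : Submodule R M) (h : HasFiltration R X N l) (e : (M ⧸ N) ≃ₗ[R] X i) :
    HasFiltration R X M (l ++ [i]) := by
  obtain ⟨F, h0, h1, h2⟩ := h
  refine ⟨fun j => if j ≤ l.length then (F j).map N.subtype else ⊤, by simp [h0], by simp,
    fun j hj => ?_⟩
  have key : ∀ (i' : ι) (P P' Q Q' : Submodule R M), P = Q → P' = Q' → Q ≤ Q' ∧
      Nonempty ((↥Q' ⧸ Q.submoduleOf Q') ≃ₗ[R] X i') → P ≤ P' ∧
      Nonempty ((↥P' ⧸ P.submoduleOf P') ≃ₗ[R] X i') := by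
    rintro i' P P' Q Q' rfl rfl h
    exact h
  have hj0 : j < l.length + 1 := by simpa using hj
  rcases Nat.lt_succ_iff_lt_or_eq.1 hj0 with hj' | rfl
  · obtain ⟨hle, ⟨e'⟩⟩ := h2 j hj'
    have hj1 : j + 1 ≤ l.length := hj'
    rw [List.getElem_append_left hj']
    exact key _ _ _ _ _ (if_pos hj'.le) (if_pos hj1) ⟨Submodule.map_mono hle,
      ⟨(subquotientEquiv N.subtype N.injective_subtype (F j) (F (j + 1))).symm.trans e'⟩⟩
  · have hi : (l ++ [i])[l.length] = i := by simp
    rw [hi]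
    refine key _ _ _ N ⊤ ?_ (if_neg (by simp)) ⟨le_top, ⟨(topQuotientEquiv N ⊤ rfl).trans e⟩⟩
    simp only [le_refl, if_true, h1, Submodule.map_top, Submodule.range_subtype]

theorem HasFiltration.exists_of_append_singleton {M : Type*} [AddCommGroup M] [Module R M]
    {l : List ι} {i : ι} (h : HasFiltration R X M (l ++ [i])) :
    ∃ N : Submodule R M, HasFiltration R X N l ∧ Nonempty ((M ⧸ N) ≃ₗ[R] X i) := by
  obtain ⟨F, h0, h1, h2⟩ := h
  have hmono : ∀ a b : ℕ, a ≤ b → b ≤ l.length → F a ≤ F b := by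
    intro a b hab
    induction b, hab using Nat.le_induction with
    | base => exact fun _ => le_rfl
    | succ b hab ih =>
      intro hb
      exact (ih (by omega)).trans (h2 b (by simp; omega)).1
  have hmap : ∀ j ≤ l.length,
      ((F j).comap (F l.length).subtype).map (F l.length).subtype = F j := fun j hj => by
    rw [Submodule.map_comap_subtype]
    exact inf_eq_right.2 (hmono j _ hj le_rfl)
  refine ⟨F l.length, ⟨fun j => (F j).comap (F l.length).subtype, ?_, ?_, fun j hj => ?_⟩, ?_⟩
  · simp [h0]
  · simp
  · obtain ⟨hle, ⟨e'⟩⟩ := h2 j (by simp; omega)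
    refine ⟨Submodule.comap_mono hle, ⟨?_⟩⟩
    have e'' := subquotientEquiv (F l.length).subtype (F l.length).injective_subtype
      ((F j).comap (F l.length).subtype) ((F (j + 1)).comap (F l.length).subtype)
    rw [hmap j hj.le, hmap (j + 1) hj] at e''
    rw [List.getElem_append_left hj] at e'
    exact e''.trans e'
  · obtain ⟨-, ⟨e'⟩⟩ := h2 l.length (by simp)
    have hi : (l ++ [i])[l.length] = i := by simp
    rw [hi] at e'
    simp only [List.length_append, List.length_singleton] at h1
    exact ⟨(topQuotientEquiv _ _ h1).symm.trans e'⟩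

theorem IsFilteredBy.of_equiv {S : Set ι} {M M' : Type*} [AddCommGroup M] [Module R M]
    [AddCommGroup M'] [Module R M'] (e : M ≃ₗ[R] M') (h : IsFilteredBy R X S M) :
    IsFilteredBy R X S M' := by
  obtain ⟨l, hl, h⟩ := h
  exact ⟨l, hl, h.of_equiv e⟩

theorem IsFilteredBy.mono {S T : Set ι} (hST : S ⊆ T) {M : Type*} [AddCommGroup M] [Module R M]
    (h : IsFilteredBy R X S M) : IsFilteredBy R X T M := by
  obtain ⟨l, hl, h⟩ := h
  exact ⟨l, fun i hi => hST (hl i hi), h⟩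

theorem IsFilteredBy.of_subsingleton {S : Set ι} (M : Type*) [AddCommGroup M] [Module R M]
    [Subsingleton M] : IsFilteredBy R X S M :=
  ⟨[], by simp, hasFiltration_nil_iff.2 inferInstance⟩

theorem IsFilteredBy.of_quotient_equiv {S : Set ι} {M : Type*} [AddCommGroup M] [Module R M]
    {N : Submodule R M} (h : IsFilteredBy R X S N) {i : ι} (hi : i ∈ S)
    (e : (M ⧸ N) ≃ₗ[R] X i) : IsFilteredBy R X S M := by
  obtain ⟨l, hl, h⟩ := h
  refine ⟨l ++ [i], fun j hj => ?_, h.append_singleton N e⟩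
  rcases List.mem_append.1 hj with hj | hj
  · exact hl j hj
  · rw [List.mem_singleton.1 hj]; exact hi

theorem IsFilteredBy.induction {S : Set ι}
    {motive : ∀ (M : Type u) [AddCommGroup M] [Module R M], Prop}
    (zero : ∀ (M : Type u) [AddCommGroup M] [Module R M], Subsingleton M → motive M)
    (step : ∀ (M : Type u) [AddCommGroup M] [Module R M] (N : Submodule R M) (i : ι), i ∈ S →
      IsFilteredBy R X S N → motive N → ∀ _ : (M ⧸ N) ≃ₗ[R] X i, motive M)
    {M : Type u} [AddCommGroup M] [Module R M] (h : IsFilteredBy R X S M) : motive M := by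
  obtain ⟨l, hl, h⟩ := h
  induction l using List.reverseRecOn generalizing M with
  | nil => exact zero M (hasFiltration_nil_iff.1 h)
  | append_singleton l i ih =>
    obtain ⟨N, hN, ⟨e⟩⟩ := h.exists_of_append_singleton
    have hl' : ∀ j ∈ l, j ∈ S := fun j hj => hl j (List.mem_append_left _ hj)
    exact step M N i (hl i (by simp)) ⟨l, hl', hN⟩ (ih hl' hN) e

theorem IsFilteredBy.of_mem {S : Set ι} {i : ι} (hi : i ∈ S) {M : Type*} [AddCommGroup M]
    [Module R M] (e : M ≃ₗ[R] X i) : IsFilteredBy R X S M :=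
  IsFilteredBy.of_quotient_equiv (N := ⊥) (IsFilteredBy.of_subsingleton _) hi
    ((Submodule.quotEquivOfEqBot ⊥ rfl).trans e)

/-- Closure under extensions, by induction on the filtration of the quotient: the preimage of its
last submodule is filtered by the induction hypothesis, and the last factor is unchanged. -/
theorem IsFilteredBy.of_submodule_quotient {S : Set ι} {L : Type u} [AddCommGroup L] [Module R L]
    (hL : IsFilteredBy R X S L) :
    ∀ {M : Type v} [AddCommGroup M] [Module R M] (N : Submodule R M), IsFilteredBy R X S N →
      ((M ⧸ N) ≃ₗ[R] L) → IsFilteredBy R X S M := by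
  refine IsFilteredBy.induction (motive := fun L _ _ => ∀ {M : Type v} [AddCommGroup M] [Module R M]
    (N : Submodule R M), IsFilteredBy R X S N → ((M ⧸ N) ≃ₗ[R] L) → IsFilteredBy R X S M) ?_ ?_ hL
  · intro L _ _ hL M _ _ N hN e
    have : Subsingleton (M ⧸ N) := e.toEquiv.subsingleton
    have hN' : N = ⊤ := Submodule.Quotient.subsingleton_iff.1 this
    exact hN.of_equiv (LinearEquiv.ofTop N hN')
  · intro L _ _ L' i hi hL' ih e' M _ _ N hN e
    set f : M →ₗ[R] L := e.toLinearMap ∘ₗ N.mkQ with hf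
    have hfs : Function.Surjective f := e.surjective.comp N.mkQ_surjective
    have hfN : LinearMap.ker f = N := by rw [hf, LinearEquiv.ker_comp, Submodule.ker_mkQ]
    have hNle : N ≤ L'.comap f := by rw [← hfN]; exact LinearMap.ker_le_comap f
    have h1 : IsFilteredBy R X S ↥(L'.comap f) := by
      refine ih (N.submoduleOf (L'.comap f))
        (hN.of_equiv (Submodule.submoduleOfEquivOfLe hNle).symm) ?_
      set g : ↥(L'.comap f) →ₗ[R] L' := f.restrict (fun x hx => hx) with hg
      have hgs : Function.Surjective g := by
        rintro ⟨y, hy⟩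
        obtain ⟨x, rfl⟩ := hfs y
        exact ⟨⟨x, hy⟩, rfl⟩
      suffices h : N.submoduleOf (L'.comap f) = LinearMap.ker g from
        (Submodule.quotEquivOfEq _ _ h).trans (g.quotKerEquivOfSurjective hgs)
      ext x
      rw [LinearMap.mem_ker, Submodule.submoduleOf, Submodule.mem_comap, ← hfN, LinearMap.mem_ker,
        hg, Subtype.ext_iff]
      rfl
    set g : M →ₗ[R] L ⧸ L' := L'.mkQ ∘ₗ f with hg
    have hgs : Function.Surjective g := L'.mkQ_surjective.comp hfs
    have h : L'.comap f = LinearMap.ker g := by rw [hg, LinearMap.ker_comp, Submodule.ker_mkQ]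
    exact h1.of_quotient_equiv hi
      (((Submodule.quotEquivOfEq _ _ h).trans (g.quotKerEquivOfSurjective hgs)).trans e')

theorem IsFilteredBy.of_exact {S : Set ι} {L : Type u} {M : Type v} {N : Type*} [AddCommGroup L]
    [Module R L] [AddCommGroup M] [Module R M] [AddCommGroup N] [Module R N]
    (f : N →ₗ[R] M) (g : M →ₗ[R] L) (hf : Function.Injective f) (hg : Function.Surjective g)
    (hfg : LinearMap.ker g = LinearMap.range f) (hN : IsFilteredBy R X S N)
    (hL : IsFilteredBy R X S L) : IsFilteredBy R X S M :=
  hL.of_submodule_quotient (LinearMap.ker g)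
    (hN.of_equiv ((LinearEquiv.ofInjective f hf).trans (LinearEquiv.ofEq _ _ hfg.symm)))
    (g.quotKerEquivOfSurjective hg)

theorem IsFilteredBy.prod {S : Set ι} {M : Type u} {N : Type v} [AddCommGroup M]
    [Module R M] [AddCommGroup N] [Module R N] (hM : IsFilteredBy R X S M)
    (hN : IsFilteredBy R X S N) : IsFilteredBy R X S (M × N) :=
  IsFilteredBy.of_exact (LinearMap.inl R M N) (LinearMap.snd R M N) LinearMap.inl_injective
    LinearMap.snd_surjective (LinearMap.range_inl R M N).symm hM hN

theorem IsFilteredBy.pi_fin {S : Set ι} {n : ℕ} {M : Fin n → Type u} [∀ j, AddCommGroup (M j)]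
    [∀ j, Module R (M j)] (h : ∀ j, IsFilteredBy R X S (M j)) :
    IsFilteredBy R X S (∀ j, M j) := by
  induction n with
  | zero => exact IsFilteredBy.of_subsingleton _
  | succ n ih =>
    exact ((h 0).prod (ih fun j => h j.succ)).of_equiv (Fin.consLinearEquiv R M)

theorem IsFilteredBy.pi {S : Set ι} {σ : Type*} [Finite σ] {M : σ → Type u}
    [∀ j, AddCommGroup (M j)] [∀ j, Module R (M j)] (h : ∀ j, IsFilteredBy R X S (M j)) :
    IsFilteredBy R X S (∀ j, M j) := by
  obtain ⟨n, ⟨e⟩⟩ := Finite.exists_equiv_fin σ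
  exact (IsFilteredBy.pi_fin (M := fun j => M (e.symm j)) fun j => h _).of_equiv
    (LinearEquiv.piCongrLeft R M e.symm)

end Filtration

/-! ### Noncommutative local rings -/

section LocalRing

/-- One of `a * b` and `1 - a * b` is a unit. The first gives `a` a right inverse as well; the
second annihilates `a` on the left, forcing `a = 0`. -/
theorem isUnit_of_mul_eq_one_of_isLocalRing {R : Type*} [Ring R] [IsLocalRing R] {a b : R}
    (h : b * a = 1) : IsUnit a := by
  rcases IsLocalRing.isUnit_or_isUnit_of_add_one (show a * b + (1 - a * b) = 1 by abel) with hu | hu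
  · obtain ⟨c, hc⟩ := hu.exists_right_inv
    have h2 : a * (b * c) = 1 := by rw [← mul_assoc]; exact hc
    have h3 : b = b * c := by
      calc b = b * (a * (b * c)) := by rw [h2, mul_one]
        _ = (b * a) * (b * c) := by rw [mul_assoc]
        _ = b * c := by rw [h, one_mul]
    rw [← h3] at h2
    exact ⟨⟨a, b, h2, h⟩, rfl⟩
  · have h2 : (1 - a * b) * a = 0 := by rw [sub_mul, mul_assoc, h]; simp
    have h3 : a = 0 := (hu.mul_right_eq_zero).1 h2
    rw [h3, mul_zero] at h
    exact absurd h zero_ne_one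

/-- If a maximal left ideal `I` missed `a`, then `i + r * a = 1` with `i ∈ I`. A unit `i` is
excluded, and a unit `r * a` makes `a` left invertible, hence a unit. -/
theorem mem_jacobson_of_not_isUnit {R : Type*} [Ring R] [IsLocalRing R] {a : R}
    (ha : ¬ IsUnit a) : a ∈ (⊥ : Ideal R).jacobson := by
  rw [Ideal.jacobson, Submodule.mem_sInf]
  rintro I ⟨-, hI⟩
  by_contra haI
  have htop : I ⊔ Ideal.span {a} = ⊤ := by
    refine hI.1.2 _ (lt_of_le_of_ne le_sup_left fun h => haI ?_)
    rw [h]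
    exact Ideal.mem_sup_right (Ideal.mem_span_singleton_self a)
  have h1 : (1 : R) ∈ I ⊔ Ideal.span {a} := htop ▸ Submodule.mem_top
  obtain ⟨i, hi, j, hj, hij⟩ := Submodule.mem_sup.1 h1
  obtain ⟨r, rfl⟩ := Ideal.mem_span_singleton'.1 hj
  rcases IsLocalRing.isUnit_or_isUnit_of_add_one hij with hu | hu
  · exact hI.ne_top (Ideal.eq_top_of_isUnit_mem I hi hu)
  · obtain ⟨c, hc⟩ := hu.exists_left_inv
    exact ha (isUnit_of_mul_eq_one_of_isLocalRing (b := c * r) (by rw [mul_assoc]; exact hc))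

theorem eq_zero_or_one_of_idempotent {R : Type*} [Ring R] [IsLocalRing R] {a : R}
    (h : IsIdempotentElem a) : a = 0 ∨ a = 1 := by
  have h0 : a * (1 - a) = 0 := by rw [mul_sub, mul_one, h.eq, sub_self]
  rcases IsLocalRing.isUnit_or_isUnit_of_add_one (show a + (1 - a) = 1 by abel) with hu | hu
  · exact Or.inr (sub_eq_zero.1 ((hu.mul_right_eq_zero).1 h0)).symm
  · exact Or.inl ((hu.mul_left_eq_zero).1 h0)

end LocalRing

/-! ### Projectivity over a subring -/

section Restriction

variable {D G : Type*} [Ring D] [Ring G] (ι : D →+* G)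

/-- The `G`-module `M` is projective as a module over `D`, by restriction along `ι : D → G`. -/
def ProjectiveAlong (M : Type*) [AddCommGroup M] [Module G M] : Prop :=
  letI : Module D M := Module.compHom M ι
  Module.Projective D M

variable {ι}

theorem ProjectiveAlong.of_retract {M : Type*} [AddCommGroup M] [Module G M]
    (hM : ProjectiveAlong ι M) {M' : Type*} [AddCommGroup M'] [Module G M']
    (i : M' →+ M) (hi : ∀ d x, i (ι d • x) = ι d • i x)
    (r : M →+ M') (hr : ∀ d x, r (ι d • x) = ι d • r x) (h : ∀ x, r (i x) = x) :
    ProjectiveAlong ι M' := by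
  let : Module D M := Module.compHom M ι
  let : Module D M' := Module.compHom M' ι
  have : Module.Projective D M := hM
  exact Module.Projective.of_split (M := M) ({ i with map_smul' := hi } : M' →ₗ[D] M)
    ({ r with map_smul' := hr } : M →ₗ[D] M') (LinearMap.ext h)

theorem ProjectiveAlong.of_equiv {M : Type*} [AddCommGroup M] [Module G M]
    (hM : ProjectiveAlong ι M) {M' : Type*} [AddCommGroup M'] [Module G M']
    (e : M ≃ₗ[G] M') : ProjectiveAlong ι M' :=
  hM.of_retract (e.symm : M' →+ M) (fun _ _ => e.symm.map_smul _ _) (e : M →+ M')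
    (fun _ _ => e.map_smul _ _) (fun x => e.apply_symm_apply x)

theorem ProjectiveAlong.of_subsingleton {M : Type*} [AddCommGroup M] [Module G M]
    [Subsingleton M] : ProjectiveAlong ι M := by
  let : Module D M := Module.compHom M ι
  exact Module.Projective.of_split (M := D) (0 : M →ₗ[D] D) 0 (LinearMap.ext fun x =>
    Subsingleton.elim _ _)

/-- The extension splits over `D`, though usually not over `G`. -/
theorem ProjectiveAlong.of_submodule_quotient {M : Type*} [AddCommGroup M] [Module G M]
    (N : Submodule G M) (hN : ProjectiveAlong ι N) (hQ : ProjectiveAlong ι (M ⧸ N)) :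
    ProjectiveAlong ι M := by
  let : Module D M := Module.compHom M ι
  let : Module D N := Module.compHom N ι
  let : Module D (M ⧸ N) := Module.compHom (M ⧸ N) ι
  have : Module.Projective D N := hN
  have : Module.Projective D (M ⧸ N) := hQ
  let i : N →ₗ[D] M := { toFun := fun x => x, map_add' := fun _ _ => rfl, map_smul' := fun _ _ => rfl }
  let p : M →ₗ[D] M ⧸ N :=
    { toFun := fun x => N.mkQ x, map_add' := map_add N.mkQ, map_smul' := fun _ _ => rfl }
  obtain ⟨s, hs⟩ := Module.projective_lifting_property p LinearMap.id N.mkQ_surjective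
  have hs' : ∀ y, N.mkQ (s y) = y := fun y => LinearMap.congr_fun hs y
  have hmem : ∀ x, x - s (p x) ∈ N := fun x => by
    refine (Submodule.Quotient.mk_eq_zero N).1 ?_
    rw [Submodule.Quotient.mk_sub, sub_eq_zero]
    exact (hs' (p x)).symm
  let t : M →ₗ[D] N :=
    { toFun := fun x => ⟨x - s (p x), hmem x⟩
      map_add' := fun x y => Subtype.ext (by
        simp only [map_add, Submodule.coe_add]; abel)
      map_smul' := fun d x => Subtype.ext (by
        change d • x - s (p (d • x)) = d • (x - s (p x))
        rw [map_smul, map_smul, smul_sub]) }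
  exact Module.Projective.of_split (M := N × (M ⧸ N)) (t.prod p) (i.coprod s) (LinearMap.ext fun x =>
    sub_add_cancel x (s (p x)))

/-- Here `M` is a retract of the regular module `D`, the retraction sending `1` to `x`. -/
theorem ProjectiveAlong.of_ring {M : Type*} [AddCommGroup M] [Module G M]
    (β : M →+ D) (hβ : ∀ d x, β (ι d • x) = d * β x) (x : M) (h : ∀ y, ι (β y) • x = y) :
    ProjectiveAlong ι M := by
  let : Module D M := Module.compHom M ι
  exact Module.Projective.of_split (M := D) ({ β with map_smul' := hβ } : M →ₗ[D] D)
    (LinearMap.toSpanSingleton D M x) (LinearMap.ext h)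

theorem ProjectiveAlong.of_sum {σ : Type*} [Fintype σ] {P : σ → Type*}
    [∀ l, AddCommGroup (P l)] [∀ l, Module G (P l)] (hP : ∀ l, ProjectiveAlong ι (P l))
    {M : Type*} [AddCommGroup M] [Module G M]
    (i : ∀ l, M →+ P l) (hi : ∀ l d x, i l (ι d • x) = ι d • i l x)
    (r : ∀ l, P l →+ M) (hr : ∀ l d x, r l (ι d • x) = ι d • r l x)
    (h : ∀ x, ∑ l, r l (i l x) = x) :
    ProjectiveAlong ι M := by
  classical
  let : Module D M := Module.compHom M ι
  let : ∀ l, Module D (P l) := fun l => Module.compHom (P l) ι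
  have : ∀ l, Module.Projective D (P l) := hP
  let i' : ∀ l, M →ₗ[D] P l := fun l => { i l with map_smul' := hi l }
  let r' : ∀ l, P l →ₗ[D] M := fun l => { r l with map_smul' := hr l }
  refine Module.Projective.of_split (M := Π₀ l, P l)
    ((DFinsupp.linearEquivFunOnFintype (R := D)).symm.toLinearMap ∘ₗ LinearMap.pi i')
    (DFinsupp.lsum ℕ r') (LinearMap.ext fun x => ?_)
  conv_rhs => rw [LinearMap.id_apply, ← h x]
  simp only [LinearMap.comp_apply, DFinsupp.lsum_apply_apply, DFinsupp.sumAddHom_apply]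
  rw [DFinsupp.sum_eq_sum_fintype]
  · rfl
  · intro l; exact map_zero (r' l)

end Restriction

/-! ### Triangular rings: from projectivity over the diagonal to filtrations -/

section Triangular

theorem mem_span_idempotent {G : Type*} [Ring G] {e : G} (he : e * e = e) {y : G} :
    y ∈ Ideal.span {e} ↔ y * e = y := by
  rw [Ideal.mem_span_singleton']
  constructor
  · rintro ⟨a, rfl⟩
    rw [mul_assoc, he]
  · intro h
    exact ⟨y, h⟩

variable {Λ : Type*} [DecidableEq Λ] {R : Λ → Type*} [∀ l, Ring (R l)]
  {G : Type*} [Ring G]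

/-- A Nakayama argument. If no such pair existed, every linear form on `M` would have its `m`-th
coordinate in the radical `J` of `R m`. Expanding vectors through a section of a free cover, if `J ^
(n + 1)` kills the `m`-component of `M` then so does `J ^ n`. Since `J` is nilpotent, `J ^ 0` kills
it, so the `m`-component is zero. -/
theorem exists_dual_element [∀ l, IsLocalRing (R l)]
    (hnil : ∀ l, ∃ n : ℕ, (⊥ : Ideal (R l)).jacobson ^ n = ⊥) {M : Type*} [AddCommGroup M]
    [Module (∀ l, R l) M] [Module.Projective (∀ l, R l) M] (m : Λ)
    (h : ∃ x : M, (Pi.single m 1 : ∀ l, R l) • x ≠ 0) :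
    ∃ (f : M →ₗ[∀ l, R l] (∀ l, R l)) (x : M),
      (Pi.single m 1 : ∀ l, R l) • x = x ∧ f x = Pi.single m 1 := by
  by_contra H
  have hunit : ∀ (f : M →ₗ[∀ l, R l] (∀ l, R l)) (x : M), ¬ IsUnit (f x m) := by
    intro f x hu
    obtain ⟨c, hc⟩ := hu.exists_left_inv
    -- A unit coordinate can be normalised to `1` by rescaling `x`, which also moves it into the
    -- `m`-component.
    refine H ⟨f, (Pi.single m c : ∀ l, R l) • x, ?_, ?_⟩
    · rw [← mul_smul, ← Pi.single_mul, one_mul]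
    · rw [map_smul, smul_eq_mul, ← hc]
      ext l
      by_cases hl : l = m
      · subst hl; simp
      · simp [Pi.single_eq_of_ne hl]
  set J := (⊥ : Ideal (R m)).jacobson with hJ
  obtain ⟨s, hs⟩ := Module.projective_def'.1 (inferInstance : Module.Projective (∀ l, R l) M)
  have hstep : ∀ n : ℕ, (∀ r ∈ J ^ (n + 1), ∀ x : M, (Pi.single m r : ∀ l, R l) • x = 0) →
      ∀ r ∈ J ^ n, ∀ x : M, (Pi.single m r : ∀ l, R l) • x = 0 := by
    intro n hn r hr x
    have hx : x = (s x).sum fun i a => a • i := (LinearMap.congr_fun hs x).symm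
    rw [hx, Finsupp.sum, Finset.smul_sum]
    refine Finset.sum_eq_zero fun i _ => ?_
    rw [← mul_smul]
    have h1 : (Pi.single m r : ∀ l, R l) * s x i = Pi.single m (r * s x i m) := by
      ext l
      by_cases hl : l = m
      · subst hl; simp
      · simp [Pi.single_eq_of_ne hl]
    rw [h1]
    refine hn _ ?_ i
    rw [Submodule.pow_succ]
    exact Ideal.mul_mem_mul hr
      (mem_jacobson_of_not_isUnit (hunit ((Finsupp.lapply i) ∘ₗ s) x))
  obtain ⟨n, hn⟩ := hnil m
  have h0 : ∀ k ≤ n, ∀ r ∈ J ^ (n - k), ∀ x : M, (Pi.single m r : ∀ l, R l) • x = 0 := by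
    intro k
    induction k with
    | zero =>
      intro _ r hr x
      rw [Nat.sub_zero, hn] at hr
      rw [(Submodule.mem_bot _).1 hr, Pi.single_zero, zero_smul]
    | succ k ih =>
      intro hk
      refine hstep _ ?_
      rw [show n - (k + 1) + 1 = n - k by omega]
      exact ih (by omega)
  obtain ⟨x, hx⟩ := h
  refine hx (h0 n le_rfl 1 ?_ x)
  rw [Nat.sub_self, Submodule.pow_zero]
  exact Ideal.one_eq_top (R := R m) ▸ Submodule.mem_top

variable [Fintype Λ] [PartialOrder Λ]

/-- The ring `G` is upper triangular for the idempotents `e l`, with diagonal `∏ R l` embedded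
by `ι` and extracted by `π`. -/
structure IsTriangular (e : Λ → G) (ι : (∀ l, R l) →+* G) (π : G →+ ∀ l, R l) : Prop where
  idem : ∀ l, e l = ι (Pi.single l 1)
  left_inv : ∀ d, π (ι d) = d
  corner : ∀ l g, e l * g * e l = ι (Pi.single l (π g l))
  directed : ∀ l m, ¬ l ≤ m → ∀ g, e m * g * e l = 0

variable {e : Λ → G} {ι : (∀ l, R l) →+* G} {π : G →+ ∀ l, R l}

namespace IsTriangular

variable (T : IsTriangular e ι π)
include T

theorem complete : CompleteOrthogonalIdempotents e := by
  have h := (CompleteOrthogonalIdempotents.single R).map ι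
  have : e = ι ∘ fun l => Pi.single l 1 := funext T.idem
  rwa [this]

theorem mul_self (l : Λ) : e l * e l = e l := T.complete.idem l

theorem mul_ne {l m : Λ} (h : l ≠ m) : e l * e m = 0 := T.complete.ortho h

theorem sum_eq : ∑ l, e l = 1 := T.complete.complete

theorem ι_injective : Function.Injective ι := Function.LeftInverse.injective T.left_inv

theorem mul_ι (l : Λ) (d : ∀ l, R l) : e l * ι d = ι (Pi.single l (d l)) := by
  rw [T.idem, ← map_mul]
  congr 1
  ext m
  by_cases hm : m = l
  · subst hm; simp
  · simp [Pi.single_eq_of_ne hm]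

theorem ι_mul (l : Λ) (d : ∀ l, R l) : ι d * e l = ι (Pi.single l (d l)) := by
  rw [T.idem, ← map_mul]
  congr 1
  ext m
  by_cases hm : m = l
  · subst hm; simp
  · simp [Pi.single_eq_of_ne hm]

theorem comm (l : Λ) (d : ∀ l, R l) : e l * ι d = ι d * e l := by rw [T.mul_ι, T.ι_mul]

theorem π_mul (d : ∀ l, R l) (g : G) : π (ι d * g) = d * π g := by
  ext l
  have h : ι (Pi.single l (π (ι d * g) l)) = ι (Pi.single l ((d * π g) l)) := by
    rw [← T.corner, ← mul_assoc, T.comm, mul_assoc, mul_assoc, ← mul_assoc (e l) g, T.corner,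
      ← map_mul]
    congr 1
    ext m
    by_cases hm : m = l
    · subst hm; simp
    · simp [Pi.single_eq_of_ne hm]
  exact Pi.single_injective l (T.ι_injective h)

theorem coe_mul (l : Λ) (y : ↥(Ideal.span {e l})) : (y : G) * e l = y :=
  (mem_span_idempotent (T.mul_self l)).1 y.2

/-- The generator of the left ideal `G e l`. -/
def gen (_ : IsTriangular e ι π) (l : Λ) : ↥(Ideal.span {e l}) :=
  ⟨e l, Ideal.mem_span_singleton_self _⟩

theorem smul_gen (l : Λ) (y : ↥(Ideal.span {e l})) : (y : G) • T.gen l = y :=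
  Subtype.ext (T.coe_mul l y)

theorem eq_sum_smul {M : Type*} [AddCommGroup M] [Module G M] (x : M) : x = ∑ l, e l • x := by
  rw [← Finset.sum_smul, T.sum_eq, one_smul]

theorem smul_self {M : Type*} [AddCommGroup M] [Module G M] (l : Λ) (x : M) :
    e l • e l • x = e l • x := by rw [← mul_smul, T.mul_self]

theorem smul_ne {M : Type*} [AddCommGroup M] [Module G M] {l m : Λ} (h : l ≠ m) (x : M) :
    e l • e m • x = 0 := by rw [← mul_smul, T.mul_ne h, zero_smul]

/-- The submodule of `G e l` spanned by the off-diagonal components. -/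
def offDiag (l : Λ) : Submodule G ↥(Ideal.span {e l}) where
  carrier := {y | e l * (y : G) = 0}
  add_mem' {a b} ha hb := by
    have ha' : e l * (a : G) = 0 := ha
    have hb' : e l * (b : G) = 0 := hb
    change e l * ((a : G) + b) = 0
    rw [mul_add, ha', hb', add_zero]
  zero_mem' := mul_zero _
  smul_mem' g y hy := by
    have hy' : e l * (y : G) = 0 := hy
    change e l * (g * (y : G)) = 0
    -- Insert `1 = ∑ e m` between `g` and `y`: the term `e l * g * e m * y` needs `m ≤ l`, and `e m
    -- * y = e m * y * e l` needs `l ≤ m`, so only `m = l` is left and there `e l * y = 0`.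
    have h1 : (y : G) = ∑ m, e m * (y : G) := T.eq_sum_smul (M := G) y
    rw [h1, Finset.mul_sum, Finset.mul_sum]
    refine Finset.sum_eq_zero fun m _ => ?_
    by_cases hml : m ≤ l
    · by_cases hml' : m = l
      · rw [hml', hy']; simp
      · have : ¬ l ≤ m := fun h => hml' (le_antisymm hml h)
        rw [← T.coe_mul l y, ← mul_assoc (e m), T.directed l m this]; simp
    · rw [← mul_assoc, ← mul_assoc, T.directed m l hml, zero_mul]

theorem mem_offDiag {l : Λ} {y : ↥(Ideal.span {e l})} : y ∈ T.offDiag l ↔ e l * (y : G) = 0 :=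
  Iff.rfl

/-- Take `m` maximal in the support of `M` and a vector `x = e m • x` with a dual form `f`. By
maximality nothing above `m` survives, so `G x` is just `R m x`, a copy of `Δ m`. The form `f`
splits it off over `D`, which keeps the quotient projective. -/
theorem exists_standard_submodule [∀ l, IsLocalRing (R l)]
    (hnil : ∀ l, ∃ n : ℕ, (⊥ : Ideal (R l)).jacobson ^ n = ⊥) {M : Type*} [AddCommGroup M]
    [Module G M] [Nontrivial M] (hM : ProjectiveAlong ι M) :
    ∃ (m : Λ) (N : Submodule G M), (∃ x : M, e m • x ≠ 0) ∧ N ≠ ⊥ ∧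
      Nonempty (N ≃ₗ[G] (↥(Ideal.span {e m}) ⧸ T.offDiag m)) ∧ ProjectiveAlong ι (M ⧸ N) := by
  classical
  obtain ⟨z, hz⟩ := exists_ne (0 : M)
  have hne : (Finset.univ.filter fun m : Λ => ∃ x : M, e m • x ≠ 0).Nonempty := by
    by_contra h
    rw [Finset.not_nonempty_iff_eq_empty, Finset.filter_eq_empty_iff] at h
    push Not at h
    apply hz
    rw [T.eq_sum_smul z]
    exact Finset.sum_eq_zero fun m _ => h (Finset.mem_univ m) z
  obtain ⟨m, hm⟩ := Finset.exists_maximal hne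
  have hmx : ∃ x : M, e m • x ≠ 0 := by simpa using hm.1
  have hgt : ∀ n, m ≤ n → n ≠ m → ∀ x : M, e n • x = 0 := by
    intro n hmn hnm x
    by_contra hx
    exact hnm (le_antisymm (hm.2 (by simpa using ⟨x, hx⟩) hmn) hmn)
  let : Module (∀ l, R l) M := Module.compHom M ι
  have hcompat : ∀ (d : ∀ l, R l) (x : M), d • x = ι d • x := fun _ _ => rfl
  have : Module.Projective (∀ l, R l) M := hM
  obtain ⟨f, x, hx, hfx⟩ := exists_dual_element hnil (M := M) m (by
    obtain ⟨x, hx⟩ := hmx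
    exact ⟨x, by rwa [hcompat, ← T.idem]⟩)
  rw [hcompat, ← T.idem] at hx
  -- In `g • x` only the `m`-component remains: components at `n > m` vanish by maximality of `m`,
  -- the others by directedness.
  have hgx : ∀ g : G, g • x = ι (Pi.single m (π g m)) • x := by
    intro g
    rw [← T.corner, mul_smul, mul_smul, hx]
    conv_lhs => rw [T.eq_sum_smul (g • x)]
    refine Finset.sum_eq_single m (fun n _ hn => ?_) (fun h => absurd (Finset.mem_univ m) h)
    by_cases hmn : m ≤ n
    · exact hgt n hmn hn _
    · conv_lhs => rw [← hx]
      rw [← mul_smul, ← mul_smul, T.directed m n hmn, zero_smul]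
  have hfg : ∀ g : G, f (g • x) = Pi.single m (π g m) := by
    intro g
    rw [hgx, ← hcompat, map_smul, hfx, smul_eq_mul, ← Pi.single_mul, mul_one]
  let φ : ↥(Ideal.span {e m}) →ₗ[G] M :=
    (LinearMap.toSpanSingleton G M x).comp (Submodule.subtype _)
  have hφ : ∀ y, φ y = (y : G) • x := fun y => rfl
  have hker : LinearMap.ker φ = T.offDiag m := by
    ext y
    rw [LinearMap.mem_ker, hφ, mem_offDiag, ← T.coe_mul m y, ← mul_assoc, T.corner]
    rw [mul_smul, hx]
    constructor
    · intro h
      rw [← hfg, h, map_zero, map_zero]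
    · intro h
      rw [hgx, h, zero_smul]
  refine ⟨m, LinearMap.range φ, hmx, ?_, ⟨?_⟩, ?_⟩
  · intro h
    have : φ (T.gen m) = 0 := by
      rw [← LinearMap.mem_ker, LinearMap.range_eq_bot.1 h, LinearMap.ker_zero]; trivial
    have h0 : x = 0 := by rw [← hx]; exact this
    rw [h0, map_zero] at hfx
    have := congrFun hfx m
    simp at this
  · exact (φ.quotKerEquivRange.symm.trans (Submodule.quotEquivOfEq _ _ hker))
  · have hrange : ∀ y ∈ LinearMap.range φ, ι (f y) • x = y := by
      rintro _ ⟨y, rfl⟩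
      rw [hφ, hfg, ← hgx]
    -- The `D`-linear section of the quotient map: subtract from `y` its projection `ι (f y) • x` to
    -- the submodule generated by `x`.
    let σ : M ⧸ LinearMap.range φ →+ M := QuotientAddGroup.lift (LinearMap.range φ).toAddSubgroup
      { toFun := fun y => y - ι (f y) • x
        map_zero' := by simp
        map_add' := fun a b => by rw [map_add, map_add, add_smul]; abel }
      (fun y hy => sub_eq_zero.2 (hrange y hy).symm)
    have hσ : ∀ y : M, σ (Submodule.Quotient.mk y) = y - ι (f y) • x := fun y => rfl
    refine ProjectiveAlong.of_retract hM σ ?_ ((LinearMap.range φ).mkQ : M →+ _)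
      (fun d y => map_smul (LinearMap.range φ).mkQ (ι d) y) ?_
    · intro d y
      obtain ⟨y, rfl⟩ := Submodule.Quotient.mk_surjective _ y
      rw [← Submodule.Quotient.mk_smul, hσ, hσ, ← hcompat, map_smul, smul_sub, smul_eq_mul,
        map_mul, mul_smul, hcompat]
    · intro y
      obtain ⟨y, rfl⟩ := Submodule.Quotient.mk_surjective _ y
      rw [hσ]
      refine (Submodule.Quotient.eq _).2 ?_
      have : y - ι (f y) • x - y = φ (-((ι (f y)) • T.gen m)) := by
        rw [map_neg, map_smul, hφ]
        change _ = - (ι (f y) • e m • x)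
        rw [hx]; abel
      rw [this]
      exact ⟨_, rfl⟩

/-- Stated for quotients of a fixed `M` so that Noetherian induction applies: splitting off one `Δ
m` from `M ⧸ N` strictly enlarges `N`. -/
theorem isFilteredBy_quotient [∀ l, IsLocalRing (R l)]
    (hnil : ∀ l, ∃ n : ℕ, (⊥ : Ideal (R l)).jacobson ^ n = ⊥) {M : Type*} [AddCommGroup M]
    [Module G M] [IsNoetherian G M] (S : Set Λ) (hS : ∀ m, (∃ x : M, e m • x ≠ 0) → m ∈ S)
    (N : Submodule G M) : ProjectiveAlong ι (M ⧸ N) →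
    IsFilteredBy G (fun m : Λ => ↥(Ideal.span {e m}) ⧸ T.offDiag m) S (M ⧸ N) := by
  induction N using IsNoetherian.induction with
  | _ N ih =>
  intro hN
  by_cases hsub : Subsingleton (M ⧸ N)
  · exact IsFilteredBy.of_subsingleton _
  rw [not_subsingleton_iff_nontrivial] at hsub
  obtain ⟨m, N', ⟨x, hx⟩, hN', ⟨e'⟩, hproj⟩ := T.exists_standard_submodule hnil hN
  have hm : m ∈ S := by
    obtain ⟨x, rfl⟩ := N.mkQ_surjective x
    refine hS m ⟨x, fun h => hx ?_⟩
    rw [← map_smul, h, map_zero]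
  have hle : N ≤ N'.comap N.mkQ := by
    conv_lhs => rw [← Submodule.ker_mkQ N]
    exact LinearMap.ker_le_comap _
  have hlt : N < N'.comap N.mkQ := by
    refine lt_of_le_of_ne hle fun h => hN' ?_
    rw [eq_bot_iff]
    intro y hy
    obtain ⟨y, rfl⟩ := N.mkQ_surjective y
    have : y ∈ N'.comap N.mkQ := hy
    rw [← h, ← Submodule.ker_mkQ N] at this
    exact this
  have hmap : (N'.comap N.mkQ).map N.mkQ = N' :=
    Submodule.map_comap_eq_of_surjective N.mkQ_surjective N'
  have e2 : ((M ⧸ N) ⧸ N') ≃ₗ[G] (M ⧸ N'.comap N.mkQ) :=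
    (Submodule.quotEquivOfEq _ _ hmap.symm).trans
      (Submodule.quotientQuotientEquivQuotient N (N'.comap N.mkQ) hle)
  have h1 := ih _ hlt (hproj.of_equiv e2)
  exact h1.of_submodule_quotient N' (IsFilteredBy.of_mem hm e') e2

theorem isFilteredBy [∀ l, IsLocalRing (R l)]
    (hnil : ∀ l, ∃ n : ℕ, (⊥ : Ideal (R l)).jacobson ^ n = ⊥) {M : Type*} [AddCommGroup M]
    [Module G M] [IsNoetherian G M] (S : Set Λ) (hS : ∀ m, (∃ x : M, e m • x ≠ 0) → m ∈ S)
    (hM : ProjectiveAlong ι M) :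
    IsFilteredBy G (fun m : Λ => ↥(Ideal.span {e m}) ⧸ T.offDiag m) S M :=
  (T.isFilteredBy_quotient hnil S hS ⊥ (hM.of_equiv
    (Submodule.quotEquivOfEqBot ⊥ rfl).symm)).of_equiv (Submodule.quotEquivOfEqBot ⊥ rfl)

end IsTriangular

end Triangular

/-! ### Triangular rings: stratifications and projectivity over the diagonal -/

section Triangular

variable {Λ : Type*} [DecidableEq Λ] {R : Λ → Type*} [∀ l, Ring (R l)]
  {G : Type*} [Ring G] [Fintype Λ] [PartialOrder Λ]
  {e : Λ → G} {ι : (∀ l, R l) →+* G} {π : G →+ ∀ l, R l}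

namespace IsTriangular

variable (T : IsTriangular e ι π)
include T

theorem ne_zero [∀ l, Nontrivial (R l)] (l : Λ) : e l ≠ 0 := by
  intro h
  rw [T.idem, ← map_zero ι] at h
  have := congrFun (T.ι_injective h) l
  simp at this

theorem smul_eq_zero_of_ne {l m : Λ} (h : m ≠ l) (z : ↥(Ideal.span {e l}) ⧸ T.offDiag l) :
    e m • z = 0 := by
  obtain ⟨z, rfl⟩ := Submodule.Quotient.mk_surjective _ z
  rw [← Submodule.Quotient.mk_smul, Submodule.Quotient.mk_eq_zero, mem_offDiag]
  change e l • e m • (z : G) = 0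
  exact T.smul_ne h.symm _

/-- Idempotents below `e l` lie in the corner `R l`, which is local. A nonzero map `G e i → G e j`
needs `j ≤ i`, so an isomorphism forces `i = j` by antisymmetry. -/
theorem isBasicFamily [∀ l, IsLocalRing (R l)] : IsBasicFamily e where
  complete := T.complete
  ne_zero := T.ne_zero
  primitive l f g hf hg hfg hgf hsum := by
    have h1 : e l * f = f := by rw [← hsum, add_mul, hgf, hf.eq, add_zero]
    have h2 : f * e l = f := by rw [← hsum, mul_add, hfg, hf.eq, add_zero]
    have h3 : f = ι (Pi.single l (π f l)) := by rw [← T.corner, h1, h2]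
    have h4 : IsIdempotentElem (π f l) := by
      have := hf.eq
      rw [h3, ← map_mul, ← Pi.single_mul] at this
      exact Pi.single_injective l (T.ι_injective this)
    rcases eq_zero_or_one_of_idempotent h4 with h | h
    · left; rw [h3, h]; simp
    · right
      rw [h, ← T.idem] at h3
      rw [h3] at hsum
      simpa using hsum
  not_iso i j hij := by
    have key : ∀ i j : Λ, (↥(Ideal.span {e i}) ≃ₗ[G] ↥(Ideal.span {e j})) → j ≤ i := by
      intro i j φ
      by_contra h
      have h1 : e i • φ (T.gen i) = φ (T.gen i) := by
        rw [← map_smul]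
        congr 1
        exact Subtype.ext (T.mul_self i)
      have h2 : φ (T.gen i) = 0 := by
        rw [← h1]
        refine Subtype.ext ?_
        change e i * ((φ (T.gen i) : ↥(Ideal.span {e j})) : G) = 0
        rw [← T.coe_mul j, ← mul_assoc]
        exact T.directed j i h _
      have h3 : T.gen i = 0 := φ.injective (h2.trans (map_zero φ).symm)
      exact T.ne_zero i (congrArg Subtype.val h3)
    exact ⟨fun φ => hij (le_antisymm (key j i φ.symm) (key i j φ))⟩

/-- The idempotent `e m` kills every subquotient of `Δ l`, but not the head of `G e m`, which is
generated by the class of `e m`. -/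
theorem not_isCompositionFactor [∀ l, Nontrivial (R l)] {l m : Λ} (h : m ≠ l) :
    ¬ IsCompositionFactor G (Head G ↥(Ideal.span {e m}))
      (↥(Ideal.span {e l}) ⧸ T.offDiag l) := by
  rintro ⟨N, N', ⟨φ⟩⟩
  have hnt : Nontrivial ↥(Ideal.span {e m}) :=
    ⟨T.gen m, 0, fun h => T.ne_zero m (congrArg Subtype.val h)⟩
  have hfin : Module.Finite G ↥(Ideal.span {e m}) :=
    Module.Finite.iff_fg.2 ⟨{e m}, by simp⟩
  have hlt := Module.jacobson_lt_top G ↥(Ideal.span {e m})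
  have hz : ∀ z : Head G ↥(Ideal.span {e m}), e m • z = 0 := by
    intro z
    obtain ⟨y, rfl⟩ := φ.surjective z
    obtain ⟨y, rfl⟩ := Submodule.Quotient.mk_surjective _ y
    rw [← map_smul, ← Submodule.Quotient.mk_smul]
    have : e m • y = 0 := Subtype.ext (T.smul_eq_zero_of_ne h (y : ↥(Ideal.span {e l}) ⧸ T.offDiag l))
    rw [this]
    simp
  have hgen : T.gen m ∈ Module.jacobson G ↥(Ideal.span {e m}) := by
    have h1 := hz (Submodule.Quotient.mk (T.gen m))
    rw [← Submodule.Quotient.mk_smul, Submodule.Quotient.mk_eq_zero] at h1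
    have h2 : e m • T.gen m = T.gen m := Subtype.ext (T.mul_self m)
    rwa [h2] at h1
  refine hlt.ne (eq_top_iff.2 fun y _ => ?_)
  rw [← T.smul_gen m y]
  exact Submodule.smul_mem _ _ hgen

/-- The map `x ↦ (x - e l * x) * e l` retracts `G` onto the off-diagonal part, and it is `D`-linear
because `e l` commutes with the diagonal. -/
theorem projectiveAlong_offDiag (hG : ProjectiveAlong ι G) (l : Λ) :
    ProjectiveAlong ι (T.offDiag l) := by
  have hmem : ∀ x : G, (x - e l * x) * e l ∈ Ideal.span {e l} := fun x =>
    Ideal.mem_span_singleton'.2 ⟨_, rfl⟩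
  have hmem' : ∀ x : G, (⟨_, hmem x⟩ : ↥(Ideal.span {e l})) ∈ T.offDiag l := fun x => by
    rw [mem_offDiag]
    change e l * ((x - e l * x) * e l) = 0
    rw [← mul_assoc, mul_sub, ← mul_assoc, T.mul_self, sub_self, zero_mul]
  refine hG.of_retract
    { toFun := fun y => ((y : ↥(Ideal.span {e l})) : G)
      map_zero' := rfl
      map_add' := fun _ _ => rfl } (fun _ _ => rfl)
    { toFun := fun x => ⟨⟨_, hmem x⟩, hmem' x⟩
      map_zero' := by
        refine Subtype.ext (Subtype.ext ?_)
        change (0 - e l * 0) * e l = 0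
        simp
      map_add' := fun x y => by
        refine Subtype.ext (Subtype.ext ?_)
        change (x + y - e l * (x + y)) * e l = (x - e l * x) * e l + (y - e l * y) * e l
        noncomm_ring } ?_ ?_
  · intro d x
    refine Subtype.ext (Subtype.ext ?_)
    change (ι d * x - e l * (ι d * x)) * e l = ι d * ((x - e l * x) * e l)
    rw [← mul_assoc (e l), T.comm, mul_assoc (ι d) (e l), ← mul_sub, mul_assoc]
  · intro y
    refine Subtype.ext (Subtype.ext ?_)
    change (((y : ↥(Ideal.span {e l})) : G) - e l * ((y : ↥(Ideal.span {e l})) : G)) * e l = _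
    rw [T.mem_offDiag.1 y.2, sub_zero, T.coe_mul]

theorem isStandardlyStratified [∀ l, IsLocalRing (R l)]
    (hnil : ∀ l, ∃ n : ℕ, (⊥ : Ideal (R l)).jacobson ^ n = ⊥) (k : Type*) [Field k] [Algebra k G]
    [Module.Finite k G] (hG : ProjectiveAlong ι G) : IsStandardlyStratified k e where
  finite := inferInstance
  basic := T.isBasicFamily
  stratified := by
    have : IsNoetherian G G := isNoetherian_of_tower k inferInstance
    refine ⟨T.offDiag, fun l m hml => T.not_isCompositionFactor fun h => hml h.le, fun l => ?_⟩
    refine T.isFilteredBy hnil _ ?_ (T.projectiveAlong_offDiag hG l)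
    -- The support of the off-diagonal part lies strictly above `l`: directedness gives `l ≤ m`, and
    -- `e l` acts as zero by definition.
    rintro m ⟨x, hx⟩
    refine lt_of_le_of_ne ?_ ?_
    · by_contra h
      refine hx (Subtype.ext (Subtype.ext ?_))
      change e m * ((x : ↥(Ideal.span {e l})) : G) = 0
      rw [← T.coe_mul l, ← mul_assoc]
      exact T.directed l m h _
    · rintro rfl
      exact hx (Subtype.ext (Subtype.ext x.2))

/-- `G e m` has a unique maximal submodule: an element whose diagonal entry is a unit of the local
ring `R m` generates everything, and if two submodules add up to `G e m`, one of them contains such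
an element. -/
theorem le_jacobson_of_ne_top [∀ l, IsLocalRing (R l)] {m : Λ}
    {N : Submodule G ↥(Ideal.span {e m})} (hN : N ≠ ⊤) :
    N ≤ Module.jacobson G ↥(Ideal.span {e m}) := by
  have htop : ∀ N : Submodule G ↥(Ideal.span {e m}), ∀ y ∈ N, IsUnit (π (y : G) m) → N = ⊤ := by
    intro N y hy hu
    obtain ⟨c, hc⟩ := hu.exists_left_inv
    have h1 : T.gen m ∈ N := by
      have : (ι (Pi.single m c) * e m) • y = T.gen m := by
        refine Subtype.ext ?_
        change (ι (Pi.single m c) * e m) * (y : G) = e m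
        rw [← T.coe_mul m y, mul_assoc, ← mul_assoc (e m), T.corner, ← map_mul, ← Pi.single_mul,
          hc, ← T.idem]
      rw [← this]
      exact N.smul_mem _ hy
    refine eq_top_iff.2 fun z _ => ?_
    rw [← T.smul_gen m z]
    exact N.smul_mem _ h1
  rw [Module.jacobson]
  refine le_sInf fun X hX => ?_
  by_contra hle
  have hsup : N ⊔ X = ⊤ := hX.2 _ (lt_of_le_of_ne le_sup_right fun h => hle (h ▸ le_sup_left))
  obtain ⟨a, ha, b, hb, hab⟩ := Submodule.mem_sup.1 (hsup ▸ Submodule.mem_top : T.gen m ∈ N ⊔ X)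
  have hab' : (a : G) + b = e m := congrArg Subtype.val hab
  have h1 : π (a : G) m + π (b : G) m = 1 := by
    rw [← Pi.add_apply, ← map_add, hab', T.idem, T.left_inv, Pi.single_eq_same]
  rcases IsLocalRing.isUnit_or_isUnit_of_add_one h1 with hu | hu
  · exact hN (htop N a ha hu)
  · exact hX.1 (htop X b hb hu)

omit T in
theorem smul_eq_zero_of_isFilteredBy {X : Λ → Type*} [∀ i, AddCommGroup (X i)]
    [∀ i, Module G (X i)] {S : Set Λ} {g : G} (hg : g * g = g)
    (hX : ∀ i ∈ S, ∀ x : X i, g • x = 0) {M : Type u}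
    [AddCommGroup M] [Module G M] (h : IsFilteredBy G X S M) (x : M) : g • x = 0 := by
  refine IsFilteredBy.induction (motive := fun M _ _ => ∀ x : M, g • x = 0) ?_ ?_ h x
  · intro M _ _ hM x
    exact Subsingleton.elim _ _
  · intro M _ _ N i hi _ hN φ x
    have h1 : φ (N.mkQ (g • x)) = 0 := by rw [map_smul, map_smul, hX i hi]
    have h2 : g • x ∈ N := by
      rw [← Submodule.ker_mkQ N, LinearMap.mem_ker]
      exact φ.injective (h1.trans (map_zero φ).symm)
    have h3 := congrArg Subtype.val (hN ⟨g • x, h2⟩)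
    change g • g • x = 0 at h3
    rwa [← mul_smul, hg] at h3

omit T in
theorem projectiveAlong_of_isFilteredBy {X : Λ → Type*} [∀ i, AddCommGroup (X i)]
    [∀ i, Module G (X i)] {S : Set Λ} (hX : ∀ i ∈ S, ProjectiveAlong ι (X i)) {M : Type u}
    [AddCommGroup M] [Module G M] (h : IsFilteredBy G X S M) : ProjectiveAlong ι M := by
  refine IsFilteredBy.induction (motive := fun M _ _ => ProjectiveAlong ι M) ?_ ?_ h
  · intro M _ _ hM
    exact ProjectiveAlong.of_subsingleton
  · intro M _ _ N i hi _ hN φ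
    exact hN.of_submodule_quotient N ((hX i hi).of_equiv φ.symm)

/-- Taking the diagonal entry identifies `Δ l` with the direct summand `R l` of `D`. -/
theorem projectiveAlong_quotient_offDiag (l : Λ) :
    ProjectiveAlong ι (↥(Ideal.span {e l}) ⧸ T.offDiag l) := by
  let β : (↥(Ideal.span {e l}) ⧸ T.offDiag l) →+ (∀ l, R l) :=
    QuotientAddGroup.lift (T.offDiag l).toAddSubgroup
      { toFun := fun y => Pi.single l (π (y : G) l)
        map_zero' := by simp
        map_add' := fun x y => by
          rw [Submodule.coe_add, map_add, Pi.add_apply, Pi.single_add] } (by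
        intro y hy
        have hy' : e l * (y : G) = 0 := hy
        change Pi.single l (π (y : G) l) = 0
        apply T.ι_injective
        rw [← T.corner, hy', zero_mul, map_zero])
  have hβ : ∀ y : ↥(Ideal.span {e l}), β (Submodule.Quotient.mk y) = Pi.single l (π (y : G) l) :=
    fun _ => rfl
  refine ProjectiveAlong.of_ring β ?_ (Submodule.Quotient.mk (T.gen l)) ?_
  · intro d y
    obtain ⟨y, rfl⟩ := Submodule.Quotient.mk_surjective _ y
    rw [← Submodule.Quotient.mk_smul, hβ, hβ]
    change Pi.single l (π (ι d * (y : G)) l) = _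
    rw [T.π_mul]
    ext m
    by_cases hm : m = l
    · subst hm; simp
    · simp [Pi.single_eq_of_ne hm]
  intro y
  obtain ⟨y, rfl⟩ := Submodule.Quotient.mk_surjective _ y
  rw [hβ, ← T.corner, mul_assoc, T.coe_mul, ← Submodule.Quotient.mk_smul, Submodule.Quotient.eq,
    mem_offDiag]
  change e l * ((e l * (y : G)) * e l - y) = 0
  rw [mul_assoc, T.coe_mul, mul_sub, ← mul_assoc, T.mul_self, sub_self]

/-- The two stratification axioms force `K l` to be the off-diagonal part of `G e l`. Then every `Δ
l` is `D`-projective, hence so are its iterated extensions `G e l`, and so is their sum `G`. -/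
theorem projectiveAlong_of_isStandardlyStratified [∀ l, IsLocalRing (R l)] (k : Type*) [Field k]
    [Algebra k G] (h : IsStandardlyStratified k e) : ProjectiveAlong ι G := by
  obtain ⟨K, hK1, hK2⟩ := h.stratified
  -- A nonzero class of `e m • y` in `Δ l` generates a quotient of `G e m`, so the head of `G e m`
  -- is a composition factor of `Δ l`. This requires `m ≤ l`, while directedness requires `l ≤ m`.
  have hmem : ∀ (l m : Λ), m ≠ l → ∀ y : ↥(Ideal.span {e l}), e m • y ∈ K l := by
    intro l m hml y
    by_contra hy
    have hlm : l ≤ m := by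
      by_contra hlm
      have : e m • y = 0 := by
        refine Subtype.ext ?_
        change e m * (y : G) = 0
        rw [← T.coe_mul l y, ← mul_assoc, T.directed l m hlm]
      rw [this] at hy
      exact hy (zero_mem _)
    refine hK1 l m (fun h => hml (le_antisymm h hlm)) ?_
    set z : ↥(Ideal.span {e l}) ⧸ K l := Submodule.Quotient.mk (e m • y) with hz
    have hz0 : z ≠ 0 := fun h => hy ((Submodule.Quotient.mk_eq_zero _).1 h)
    have hez : e m • z = z := by
      rw [hz, ← Submodule.Quotient.mk_smul, T.smul_self]
    let φ : ↥(Ideal.span {e m}) →ₗ[G] (↥(Ideal.span {e l}) ⧸ K l) :=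
      (LinearMap.toSpanSingleton G _ z).comp (Submodule.subtype _)
    have hker : LinearMap.ker φ ≤ Module.jacobson G ↥(Ideal.span {e m}) := by
      refine T.le_jacobson_of_ne_top fun htop => hz0 ?_
      have : φ (T.gen m) = 0 := by rw [← LinearMap.mem_ker, htop]; trivial
      rw [← hez]
      exact this
    refine ⟨LinearMap.range φ, (Module.jacobson G ↥(Ideal.span {e m})).map φ.rangeRestrict, ⟨?_⟩⟩
    let ψ := ((Module.jacobson G ↥(Ideal.span {e m})).map φ.rangeRestrict).mkQ ∘ₗ φ.rangeRestrict
    have hψ : Function.Surjective ψ :=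
      (Submodule.mkQ_surjective _).comp φ.surjective_rangeRestrict
    have hkψ : LinearMap.ker ψ = Module.jacobson G ↥(Ideal.span {e m}) := by
      rw [LinearMap.ker_comp, Submodule.ker_mkQ, Submodule.comap_map_eq, LinearMap.ker_rangeRestrict]
      exact sup_eq_left.2 hker
    exact (ψ.quotKerEquivOfSurjective hψ).symm.trans (Submodule.quotEquivOfEq _ _ hkψ)
  -- The factors `Δ m` of `K l` have `m > l`, and `e l` kills `G e m` for those.
  have hdiag : ∀ l, ∀ y : K l, e l • y = 0 := by
    intro l y
    refine smul_eq_zero_of_isFilteredBy (T.mul_self l) ?_ (hK2 l) y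
    intro m (hm : l < m) x
    obtain ⟨x, rfl⟩ := Submodule.Quotient.mk_surjective _ x
    rw [← Submodule.Quotient.mk_smul]
    have : e l • x = 0 := by
      refine Subtype.ext ?_
      change e l * (x : G) = 0
      rw [← T.coe_mul m x, ← mul_assoc, T.directed m l hm.not_ge]
    rw [this]
    rfl
  have hKeq : ∀ l, K l = T.offDiag l := by
    intro l
    ext y
    rw [mem_offDiag]
    constructor
    · intro hy
      exact congrArg (fun z : K l => ((z : ↥(Ideal.span {e l})) : G)) (hdiag l ⟨y, hy⟩)
    · intro hy
      rw [T.eq_sum_smul y]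
      refine Submodule.sum_mem _ fun m _ => ?_
      by_cases hm : m = l
      · have : e m • y = 0 := by rw [hm]; exact Subtype.ext hy
        rw [this]
        exact zero_mem _
      · exact hmem l m hm y
  have hΔ : ∀ l, ProjectiveAlong ι (↥(Ideal.span {e l}) ⧸ K l) := fun l => by
    rw [hKeq l]
    exact T.projectiveAlong_quotient_offDiag l
  have hP : ∀ l, ProjectiveAlong ι ↥(Ideal.span {e l}) := fun l =>
    ProjectiveAlong.of_submodule_quotient (K l)
      (projectiveAlong_of_isFilteredBy (fun m _ => hΔ m) (hK2 l)) (hΔ l)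
  refine ProjectiveAlong.of_sum hP
    (fun l => { toFun := fun x => ⟨x * e l, Ideal.mem_span_singleton'.2 ⟨x, rfl⟩⟩
                map_zero' := Subtype.ext (zero_mul _)
                map_add' := fun x y => Subtype.ext (add_mul x y _) })
    (fun l d x => Subtype.ext (mul_assoc _ _ _))
    (fun l => (Submodule.subtype (Ideal.span {e l}) : ↥(Ideal.span {e l}) →+ G))
    (fun l d x => rfl) fun x => ?_
  change ∑ l, x * e l = x
  rw [← Finset.mul_sum, T.sum_eq, mul_one]

end IsTriangular

end Triangular

/-! ### Splitting and reordering of filtrations; kernels of epimorphisms in `F(Θ)` -/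

section Modules

variable {A : Type u} [Ring A]

theorem exists_lift_of_subsingleton_ext {X Y Z : Type u} [AddCommGroup X] [Module A X]
    [AddCommGroup Y] [Module A Y] [AddCommGroup Z] [Module A Z] (p : X →ₗ[A] Y)
    (hp : Function.Surjective p)
    (h : Subsingleton (Abelian.Ext (ModuleCat.of A Z) (ModuleCat.of A (LinearMap.ker p)) 1))
    (f : Z →ₗ[A] Y) : ∃ g : Z →ₗ[A] X, p ∘ₗ g = f := by
  obtain ⟨x, hx⟩ := Abelian.Ext.covariant_sequence_exact₃ (ModuleCat.of A Z)
    (LinearMap.shortExact_shortComplexKer hp) (Abelian.Ext.mk₀ (ModuleCat.ofHom f)) (zero_add 1)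
    (Subsingleton.elim (h := h) _ _)
  obtain ⟨g, rfl⟩ := (Abelian.Ext.mk₀_bijective _ _).2 x
  rw [Abelian.Ext.mk₀_comp_mk₀] at hx
  have h1 := (Abelian.Ext.mk₀_bijective _ _).1 hx
  exact ⟨g.hom, congrArg ModuleCat.Hom.hom h1⟩

theorem exists_factor {X Y Z : Type*} [AddCommGroup X] [Module A X] [AddCommGroup Y] [Module A Y]
    [AddCommGroup Z] [Module A Z] (p : X →ₗ[A] Y) (hp : Function.Surjective p) (f : X →ₗ[A] Z)
    (h : LinearMap.ker p ≤ LinearMap.ker f) : ∃ g : Y →ₗ[A] Z, g ∘ₗ p = f := by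
  refine ⟨(LinearMap.ker p).liftQ f h ∘ₗ (p.quotKerEquivOfSurjective hp).symm.toLinearMap, ?_⟩
  ext x
  have : (p.quotKerEquivOfSurjective hp).symm (p x) = (LinearMap.ker p).mkQ x := by
    rw [LinearEquiv.symm_apply_eq]; rfl
  simp [this]

/-- For a section `s` of `g`, the complement of the image of `s` is the kernel of `g`. -/
noncomputable def quotientRangeSectionEquiv {X Z : Type*} [AddCommGroup X] [Module A X]
    [AddCommGroup Z] [Module A Z] (g : X →ₗ[A] Z) (s : Z →ₗ[A] X) (h : ∀ z, g (s z) = z) :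
    (X ⧸ LinearMap.range s) ≃ₗ[A] LinearMap.ker g :=
  have hmem : ∀ x, (LinearMap.id - s ∘ₗ g : X →ₗ[A] X) x ∈ LinearMap.ker g := fun x => by simp [h]
  let t : X →ₗ[A] LinearMap.ker g := (LinearMap.id - s ∘ₗ g).codRestrict _ hmem
  have ht : Function.Surjective t := fun ⟨x, hx⟩ => ⟨x, Subtype.ext (by
    have hx' : g x = 0 := hx
    simp [t, hx'])⟩
  have hk : LinearMap.range s = LinearMap.ker t := by
    ext x
    rw [LinearMap.mem_ker, Subtype.ext_iff]
    constructor
    · rintro ⟨z, rfl⟩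
      simp [t, h]
    · intro hx
      have hx' : x - s (g x) = 0 := hx
      exact ⟨g x, (sub_eq_zero.1 hx').symm⟩
  (Submodule.quotEquivOfEq _ _ hk).trans (t.quotKerEquivOfSurjective ht)

section Simple

theorem le_jacobson_of_simple_head {M : Type*} [AddCommGroup M] [Module A M] [Module.Finite A M]
    (h : IsSimpleModule A (Head A M)) {N : Submodule A M} (hN : N ≠ ⊤) :
    N ≤ Module.jacobson A M := by
  have hco : IsCoatom (Module.jacobson A M) := isSimpleModule_iff_isCoatom.1 h
  obtain h1 | ⟨T, hT, hNT⟩ := eq_top_or_exists_le_coatom N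
  · exact absurd h1 hN
  · have hle : Module.jacobson A M ≤ T := sInf_le hT
    rcases hco.le_iff.1 hle with h2 | h2
    · exact absurd h2 hT.1
    · rwa [← h2]

theorem eq_top_or_eq_top_of_sup {M : Type*} [AddCommGroup M] [Module A M] [Module.Finite A M]
    (h : IsSimpleModule A (Head A M)) {N N' : Submodule A M} (hN : N ⊔ N' = ⊤) :
    N = ⊤ ∨ N' = ⊤ := by
  by_contra! hcon
  have h1 := sup_le (le_jacobson_of_simple_head h hcon.1) (le_jacobson_of_simple_head h hcon.2)
  rw [hN] at h1
  exact (isSimpleModule_iff_isCoatom.1 h).1 (top_le_iff.1 h1)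

theorem nonempty_head_equiv {M M' : Type*} [AddCommGroup M] [Module A M] [Module.Finite A M]
    [AddCommGroup M'] [Module A M'] (h : IsSimpleModule A (Head A M))
    (h' : IsSimpleModule A (Head A M')) (f : M →ₗ[A] Head A M') (hf : f ≠ 0) :
    Nonempty (Head A M ≃ₗ[A] Head A M') := by
  have hs : Function.Surjective f := LinearMap.surjective_of_ne_zero hf
  have h1 : IsCoatom (LinearMap.ker f) := by
    rw [← isSimpleModule_iff_isCoatom]
    exact IsSimpleModule.congr (f.quotKerEquivOfSurjective hs)
  have h2 : LinearMap.ker f ≤ Module.jacobson A M := le_jacobson_of_simple_head h h1.1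
  have h3 : Module.jacobson A M = LinearMap.ker f := le_antisymm (sInf_le h1) h2
  exact ⟨(Submodule.quotEquivOfEq _ _ h3).trans (f.quotKerEquivOfSurjective hs)⟩

end Simple

section Kernels

variable {ι : Type*} {X : ι → Type*} [∀ i, AddCommGroup (X i)] [∀ i, Module A (X i)] {S : Set ι}

/-- When `φ` is already onto on `N`, the kernel of `φ` is an extension of `M ⧸ N` by the kernel on
`N`. -/
theorem IsFilteredBy.ker_of_surjective_restrict {M Z : Type*} [AddCommGroup M] [Module A M]
    [AddCommGroup Z] [Module A Z] (φ : M →ₗ[A] Z) (N : Submodule A M)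
    (hs : Function.Surjective (φ ∘ₗ N.subtype))
    (h1 : IsFilteredBy A X S (LinearMap.ker (φ ∘ₗ N.subtype))) (h2 : IsFilteredBy A X S (M ⧸ N)) :
    IsFilteredBy A X S (LinearMap.ker φ) := by
  let f : LinearMap.ker (φ ∘ₗ N.subtype) →ₗ[A] LinearMap.ker φ :=
    (N.subtype ∘ₗ (LinearMap.ker (φ ∘ₗ N.subtype)).subtype).codRestrict _ fun x => x.2
  refine IsFilteredBy.of_exact f (N.mkQ ∘ₗ (LinearMap.ker φ).subtype) ?_ ?_ ?_ h1 h2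
  · intro x y hxy
    exact Subtype.ext (Subtype.ext (congrArg (fun z : LinearMap.ker φ => (z : M)) hxy))
  · intro y
    obtain ⟨x, rfl⟩ := N.mkQ_surjective y
    obtain ⟨n, hn⟩ := hs (φ x)
    have hn' : φ n = φ x := hn
    refine ⟨⟨x - n, by simp [hn']⟩, ?_⟩
    change N.mkQ (x - n) = N.mkQ x
    rw [map_sub, sub_eq_self, ← LinearMap.mem_ker, Submodule.ker_mkQ]
    exact n.2
  · ext x
    rw [LinearMap.mem_ker]
    constructor
    · intro hx
      have hx' : (x : M) ∈ N := by rw [← Submodule.ker_mkQ N]; exact hx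
      exact ⟨⟨⟨x, hx'⟩, x.2⟩, rfl⟩
    · rintro ⟨y, rfl⟩
      change N.mkQ (y : N) = 0
      rw [← LinearMap.mem_ker, Submodule.ker_mkQ]
      exact (y : N).2

theorem IsFilteredBy.ker_of_ker_liftQ {M Z : Type*} [AddCommGroup M] [Module A M]
    [AddCommGroup Z] [Module A Z] (φ : M →ₗ[A] Z) (N : Submodule A M)
    (hN : N ≤ LinearMap.ker φ) (h1 : IsFilteredBy A X S N)
    (h2 : IsFilteredBy A X S (LinearMap.ker (N.liftQ φ hN))) :
    IsFilteredBy A X S (LinearMap.ker φ) := by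
  let g : LinearMap.ker φ →ₗ[A] LinearMap.ker (N.liftQ φ hN) :=
    (N.mkQ ∘ₗ (LinearMap.ker φ).subtype).codRestrict _ fun x => x.2
  refine IsFilteredBy.of_exact (Submodule.inclusion hN) g (Submodule.inclusion_injective hN)
    ?_ ?_ h1 h2
  · rintro ⟨y, hy⟩
    obtain ⟨x, rfl⟩ := N.mkQ_surjective y
    exact ⟨⟨x, hy⟩, rfl⟩
  · ext x
    rw [LinearMap.mem_ker, Subtype.ext_iff]
    change N.mkQ (x : M) = 0 ↔ _
    rw [← LinearMap.mem_ker, Submodule.ker_mkQ, Submodule.range_inclusion]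
    rfl

end Kernels

section System

variable {Λ : Type u} {Θ : Λ → Type u} [∀ l, AddCommGroup (Θ l)] [∀ l, Module A (Θ l)]

theorem IsFilteredBy.inF {S : Set Λ} {M : Type u} [AddCommGroup M] [Module A M]
    (h : IsFilteredBy A Θ S M) : InF A Θ M := h.mono (Set.subset_univ _)

theorem IsFilteredBy.finite (hfin : ∀ l, Module.Finite A (Θ l)) {S : Set Λ} {M : Type u}
    [AddCommGroup M] [Module A M] (h : IsFilteredBy A Θ S M) : Module.Finite A M := by
  refine IsFilteredBy.induction (motive := fun M _ _ => Module.Finite A M) ?_ ?_ h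
  · intro M _ _ _
    infer_instance
  · intro M _ _ N i _ _ hN e
    have := hfin i
    have : Module.Finite A (M ⧸ N) := Module.Finite.equiv e.symm
    exact Module.Finite.of_submodule_quotient N

/-- A nonzero map to the simple module `top (Θ j)` is nonzero on some factor `Θ i` of the
filtration; then `top (Θ i) ≅ top (Θ j)`, so `i = j`. -/
theorem mem_of_hom_head_ne_zero (hfin : ∀ l, Module.Finite A (Θ l))
    (hTop : ∀ l, IsSimpleModule A (Head A (Θ l)))
    (hTop' : ∀ l m, l ≠ m → IsEmpty (Head A (Θ l) ≃ₗ[A] Head A (Θ m))) {S : Set Λ} {j : Λ}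
    {M : Type u} [AddCommGroup M] [Module A M] (h : IsFilteredBy A Θ S M)
    (ψ : M →ₗ[A] Head A (Θ j)) (hψ : ψ ≠ 0) : j ∈ S := by
  revert ψ
  refine IsFilteredBy.induction
    (motive := fun M _ _ => ∀ ψ : M →ₗ[A] Head A (Θ j), ψ ≠ 0 → j ∈ S) ?_ ?_ h
  · intro M _ _ _ ψ hψ
    exact absurd (Subsingleton.elim _ _) hψ
  · intro M _ _ N i hi _ hN e ψ hψ
    by_cases h0 : ψ ∘ₗ N.subtype = 0
    · have hle : N ≤ LinearMap.ker ψ := fun x hx => LinearMap.congr_fun h0 ⟨x, hx⟩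
      have hne : (N.liftQ ψ hle) ∘ₗ e.symm.toLinearMap ≠ 0 := by
        intro hz
        apply hψ
        ext x
        have := LinearMap.congr_fun hz (e (N.mkQ x))
        simpa using this
      by_contra hj
      have hij : i ≠ j := fun h => hj (h ▸ hi)
      obtain ⟨φ⟩ := nonempty_head_equiv (hTop i) (hTop j) _ hne
      exact (hTop' i j hij).false φ
    · exact hN _ h0

variable [PartialOrder Λ]

theorem hom_eq_zero_of_isFilteredBy (hΘ : ∀ l m, ¬ l ≤ m → ∀ f : Θ l →ₗ[A] Θ m, f = 0)
    {S S' : Set Λ} (hS : ∀ s ∈ S, ∀ t ∈ S', ¬ s ≤ t) {M M' : Type u} [AddCommGroup M] [Module A M]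
    [AddCommGroup M'] [Module A M'] (h : IsFilteredBy A Θ S M) (h' : IsFilteredBy A Θ S' M')
    (f : M →ₗ[A] M') : f = 0 := by
  have key : ∀ t ∈ S', ∀ g : M →ₗ[A] Θ t, g = 0 := by
    intro t ht
    refine IsFilteredBy.induction (motive := fun M _ _ => ∀ g : M →ₗ[A] Θ t, g = 0) ?_ ?_ h
    · intro M _ _ _ g
      exact Subsingleton.elim _ _
    · intro M _ _ N i hi _ hN e g
      have h0 := hN (g ∘ₗ N.subtype)
      have hle : N ≤ LinearMap.ker g := fun x hx => LinearMap.congr_fun h0 ⟨x, hx⟩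
      have hz := hΘ i t (hS i hi t ht) ((N.liftQ g hle) ∘ₗ e.symm.toLinearMap)
      ext x
      have := LinearMap.congr_fun hz (e (N.mkQ x))
      simpa using this
  revert f
  refine IsFilteredBy.induction (motive := fun M' _ _ => ∀ f : M →ₗ[A] M', f = 0) ?_ ?_ h'
  · intro M' _ _ _ f
    exact Subsingleton.elim _ _
  · intro M' _ _ N i hi _ hN e f
    have h0 := key i hi (e.toLinearMap ∘ₗ N.mkQ ∘ₗ f)
    have hmem : ∀ x, f x ∈ N := fun x => by
      rw [← Submodule.ker_mkQ N, LinearMap.mem_ker]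
      have := LinearMap.congr_fun h0 x
      simpa using this
    have h1 := hN (f.codRestrict N hmem)
    ext x
    exact congrArg Subtype.val (LinearMap.congr_fun h1 x)

variable {Q : Λ → Type u} [∀ l, AddCommGroup (Q l)] [∀ l, Module A (Q l)]

namespace IsEPSS

variable (hE : IsEPSS A Θ Q)
include hE

theorem exists_lift {X Y : Type u} [AddCommGroup X] [Module A X] [AddCommGroup Y] [Module A Y]
    (p : X →ₗ[A] Y) (hp : Function.Surjective p) (hk : InF A Θ (LinearMap.ker p)) (l : Λ)
    (f : Q l →ₗ[A] Y) : ∃ g : Q l →ₗ[A] X, p ∘ₗ g = f :=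
  exists_lift_of_subsingleton_ext p hp (hE.ext_eq_zero _ hk l) f

/-- An epimorphism onto `Θ l` whose kernel is filtered by modules `Θ m` with `l ≮ m` splits. -/
theorem exists_section {X : Type u} [AddCommGroup X] [Module A X] {l : Λ} (g : X →ₗ[A] Θ l)
    (hg : Function.Surjective g) {S : Set Λ} (hk : IsFilteredBy A Θ S (LinearMap.ker g))
    (hS : ∀ m ∈ S, ¬ l < m) : ∃ s : Θ l →ₗ[A] X, ∀ z, g (s z) = z := by
  obtain ⟨p, hp, hpk⟩ := hE.exact l
  obtain ⟨q, hq⟩ := hE.exists_lift g hg hk.inF l p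
  have hmem : ∀ x : LinearMap.ker p, q x ∈ LinearMap.ker g := fun x => by
    rw [LinearMap.mem_ker, ← LinearMap.comp_apply, hq]
    exact x.2
  -- The lift of `Q l → Θ l` carries `K l` into the kernel of `g`. A nonzero map there would need `l
  -- < s ≤ t` with `t ∈ S`, so the lift kills `K l` and descends to the section.
  have h0 := hom_eq_zero_of_isFilteredBy hE.hom_eq_zero (S := {m | l < m}) (S' := S)
    (fun s (hs : l < s) t ht hst => hS t ht (hs.trans_le hst)) hpk hk
    ((q ∘ₗ (LinearMap.ker p).subtype).codRestrict _ hmem)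
  obtain ⟨s, hs⟩ := exists_factor p hp q fun x hx =>
    congrArg Subtype.val (LinearMap.congr_fun h0 ⟨x, hx⟩)
  refine ⟨s, fun z => ?_⟩
  obtain ⟨y, rfl⟩ := hp z
  have h1 : s (p y) = q y := LinearMap.congr_fun hs y
  rw [h1]
  exact LinearMap.congr_fun hq y

/-- Filtrations can be reordered so that the factors indexed by an upper set `U` come first: a
factor `Θ i` with `i ∈ U` sitting on top of factors outside `U` splits off and can be moved down. -/
theorem exists_submodule_of_isUpperSet {U : Set Λ} (hU : IsUpperSet U) {S : Set Λ} {X : Type u}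
    [AddCommGroup X] [Module A X] (hX : IsFilteredBy A Θ S X) :
    ∃ N : Submodule A X, IsFilteredBy A Θ (S ∩ U) N ∧ IsFilteredBy A Θ (S \ U) (X ⧸ N) := by
  refine IsFilteredBy.induction (motive := fun X _ _ => ∃ N : Submodule A X,
    IsFilteredBy A Θ (S ∩ U) N ∧ IsFilteredBy A Θ (S \ U) (X ⧸ N)) ?_ ?_ hX
  · intro X _ _ _
    exact ⟨⊥, IsFilteredBy.of_subsingleton _, IsFilteredBy.of_subsingleton _⟩
  intro X _ _ X₁ i hi _ hX₁ e
  obtain ⟨N₁, hN₁, hQ₁⟩ := hX₁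
  set N₂ := N₁.map X₁.subtype with hN₂
  have hN₂F : IsFilteredBy A Θ (S ∩ U) N₂ :=
    hN₁.of_equiv (Submodule.equivMapOfInjective _ X₁.injective_subtype N₁)
  have hle : N₂ ≤ X₁ := by rintro _ ⟨x, _, rfl⟩; exact x.2
  let f : (X₁ ⧸ N₁) →ₗ[A] (X ⧸ N₂) := N₁.mapQ N₂ X₁.subtype (Submodule.le_comap_map _ _)
  have hf : Function.Injective f := by
    rw [← LinearMap.ker_eq_bot, eq_bot_iff]
    intro y hy
    obtain ⟨y, rfl⟩ := N₁.mkQ_surjective y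
    have h1 : N₂.mkQ (y : X) = 0 := hy
    rw [← LinearMap.mem_ker, Submodule.ker_mkQ] at h1
    obtain ⟨z, hz, hzy⟩ := h1
    have : z = y := Subtype.ext hzy
    rw [Submodule.mem_bot, ← LinearMap.mem_ker, Submodule.ker_mkQ, ← this]
    exact hz
  let g : (X ⧸ N₂) →ₗ[A] Θ i := e.toLinearMap ∘ₗ Submodule.factor hle
  have hgmk : ∀ x, g (N₂.mkQ x) = e (X₁.mkQ x) := fun x => rfl
  have hg : Function.Surjective g := e.surjective.comp (Submodule.factor_surjective hle)
  have hfg : LinearMap.ker g = LinearMap.range f := by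
    ext y
    obtain ⟨y, rfl⟩ := N₂.mkQ_surjective y
    rw [LinearMap.mem_ker, hgmk, LinearEquiv.map_eq_zero_iff]
    constructor
    · intro h
      rw [← LinearMap.mem_ker, Submodule.ker_mkQ] at h
      exact ⟨N₁.mkQ ⟨y, h⟩, rfl⟩
    · rintro ⟨z, hz⟩
      obtain ⟨z, rfl⟩ := N₁.mkQ_surjective z
      have hz' : N₂.mkQ (z : X) = N₂.mkQ y := hz
      rw [← e.map_eq_zero_iff, ← hgmk, ← hz', hgmk, e.map_eq_zero_iff, ← LinearMap.mem_ker,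
        Submodule.ker_mkQ]
      exact z.2
  by_cases hiU : i ∈ U
  · have hkF : IsFilteredBy A Θ (S \ U) (LinearMap.ker g) :=
      hQ₁.of_equiv ((LinearEquiv.ofInjective f hf).trans (LinearEquiv.ofEq _ _ hfg.symm))
    -- The new submodule is the preimage in `X` of the split copy of `Θ i` inside `X ⧸ N₂`; dividing
    -- it out leaves the kernel of `g`, which has only factors outside `U`.
    obtain ⟨s, hs⟩ := hE.exists_section g hg hkF fun m hm hlt => hm.2 (hU hlt.le hiU)
    let t : X →ₗ[A] ((X ⧸ N₂) ⧸ LinearMap.range s) := (LinearMap.range s).mkQ ∘ₗ N₂.mkQ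
    have ht : Function.Surjective t :=
      (Submodule.mkQ_surjective _).comp (Submodule.mkQ_surjective _)
    have hkt : ∀ x, x ∈ LinearMap.ker t ↔ ∃ z, s z = N₂.mkQ x := fun x => by
      rw [LinearMap.ker_comp, Submodule.ker_mkQ]
      rfl
    refine ⟨LinearMap.ker t, ?_, hkF.of_equiv ((t.quotKerEquivOfSurjective ht).trans
      (quotientRangeSectionEquiv g s hs)).symm⟩
    have hNt : N₂ ≤ LinearMap.ker t := fun x hx => by
      rw [hkt]
      refine ⟨0, ?_⟩
      rw [map_zero]
      exact ((Submodule.Quotient.mk_eq_zero _).2 hx).symm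
    refine IsFilteredBy.of_exact (Submodule.inclusion hNt)
      (g ∘ₗ N₂.mkQ ∘ₗ (LinearMap.ker t).subtype) (Submodule.inclusion_injective hNt) ?_ ?_ hN₂F
      (IsFilteredBy.of_mem (S := S ∩ U) ⟨hi, hiU⟩ (LinearEquiv.refl A (Θ i)))
    · intro z
      obtain ⟨x, hx⟩ := N₂.mkQ_surjective (s z)
      refine ⟨⟨x, (hkt x).2 ⟨z, hx.symm⟩⟩, ?_⟩
      change g (N₂.mkQ x) = z
      rw [hx, hs]
    · ext x
      rw [LinearMap.mem_ker, Submodule.range_inclusion]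
      obtain ⟨z, hz⟩ := (hkt x).1 x.2
      change g (N₂.mkQ (x : X)) = 0 ↔ (x : X) ∈ N₂
      rw [← hz, hs]
      constructor
      · rintro rfl
        rw [map_zero] at hz
        exact (Submodule.Quotient.mk_eq_zero _).1 hz.symm
      · intro hx
        have : N₂.mkQ (x : X) = 0 := (Submodule.Quotient.mk_eq_zero _).2 hx
        rw [← hs z, hz, this, map_zero]
  · exact ⟨N₂, hN₂F, IsFilteredBy.of_exact f g hf hg hfg hQ₁
      (IsFilteredBy.of_mem (S := S \ U) ⟨hi, hiU⟩ (LinearEquiv.refl A (Θ i)))⟩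

variable (hTop : ∀ l, IsSimpleModule A (Head A (Θ l)))
  (hTop' : ∀ l m, l ≠ m → IsEmpty (Head A (Θ l) ≃ₗ[A] Head A (Θ m)))
include hTop

/-- Self-extensions of `Θ j` split, so `X` is the submodule `X₁` plus a copy of `Θ j`. Since the top
of `Θ j` is simple, `φ` is onto on one of the two; on `Θ j` itself it is then an isomorphism, and
the kernel is a copy of `X₁`. -/
theorem ker_isFilteredBy_singleton [IsNoetherianRing A] {j : Λ} {X : Type u} [AddCommGroup X] [Module A X]
    (hX : IsFilteredBy A Θ {j} X) (φ : X →ₗ[A] Θ j) (hφ : Function.Surjective φ) :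
    IsFilteredBy A Θ {j} (LinearMap.ker φ) := by
  have hfin := hE.finite_Θ
  revert φ
  refine IsFilteredBy.induction (motive := fun X _ _ => ∀ φ : X →ₗ[A] Θ j,
    Function.Surjective φ → IsFilteredBy A Θ {j} (LinearMap.ker φ)) ?_ ?_ hX
  · intro X _ _ _ φ _
    exact IsFilteredBy.of_subsingleton _
  · intro X _ _ X₁ i hi hX₁ ih e φ hφ
    obtain rfl : i = j := hi
    by_cases h1 : Function.Surjective (φ ∘ₗ X₁.subtype)
    · exact IsFilteredBy.ker_of_surjective_restrict φ X₁ h1 (ih _ h1)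
        (IsFilteredBy.of_mem (Set.mem_singleton i) e)
    · have hker : LinearMap.ker (e.toLinearMap ∘ₗ X₁.mkQ) = X₁ := by
        rw [LinearEquiv.ker_comp, Submodule.ker_mkQ]
      have hkF : IsFilteredBy A Θ {i} (LinearMap.ker (e.toLinearMap ∘ₗ X₁.mkQ)) :=
        hX₁.of_equiv (LinearEquiv.ofEq _ _ hker.symm)
      obtain ⟨s, hs⟩ := hE.exists_section (e.toLinearMap ∘ₗ X₁.mkQ)
        (e.surjective.comp X₁.mkQ_surjective) hkF (by rintro m rfl; exact lt_irrefl _)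
      have hsup : LinearMap.range (φ ∘ₗ X₁.subtype) ⊔ LinearMap.range (φ ∘ₗ s) = ⊤ := by
        refine eq_top_iff.2 fun z _ => ?_
        obtain ⟨x, rfl⟩ := hφ z
        set y := s (e (X₁.mkQ x)) with hy
        have hxy : x - y ∈ X₁ := by
          rw [← hker, LinearMap.mem_ker, map_sub, hy, hs]
          simp
        refine Submodule.mem_sup.2 ⟨φ (x - y), ⟨⟨x - y, hxy⟩, rfl⟩, φ y, ⟨e (X₁.mkQ x), rfl⟩, ?_⟩
        rw [map_sub, sub_add_cancel]
      have hφs : Function.Surjective (φ ∘ₗ s) := by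
        rcases eq_top_or_eq_top_of_sup (hTop i) hsup with h | h
        · exact absurd (LinearMap.range_eq_top.1 h) h1
        · exact LinearMap.range_eq_top.1 h
      have hfi := hfin i
      have hinj : Function.Injective (φ ∘ₗ s) :=
        IsNoetherian.injective_of_surjective_endomorphism _ hφs
      refine IsFilteredBy.ker_of_surjective_restrict φ (LinearMap.range s) ?_ ?_
        (hkF.of_equiv (quotientRangeSectionEquiv _ s hs).symm)
      · intro z
        obtain ⟨w, hw⟩ := hφs z
        exact ⟨⟨s w, w, rfl⟩, hw⟩
      · have hbot : LinearMap.ker (φ ∘ₗ (LinearMap.range s).subtype) = ⊥ := by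
          rw [eq_bot_iff]
          rintro ⟨_, w, rfl⟩ hw
          have hw' : (φ ∘ₗ s) w = 0 := hw
          have hw0 : w = 0 := hinj (hw'.trans (map_zero _).symm)
          refine (Submodule.mem_bot _).2 (Subtype.ext ?_)
          simp [hw0]
        rw [hbot]
        exact IsFilteredBy.of_subsingleton _

include hTop'

/-- Reordering reduces to the case where all factors are `Θ j`. Factors `Θ a` with `a < j` are put
on top; they cannot reach the top of `Θ j`, so `φ` is onto on the rest `N`. Factors with `a ≰ j` are
put at the bottom, where `φ` vanishes. -/
theorem inF_ker_of_surjective_Θ [IsNoetherianRing A] {j : Λ} {X : Type u} [AddCommGroup X] [Module A X]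
    (hX : InF A Θ X) (φ : X →ₗ[A] Θ j) (hφ : Function.Surjective φ) :
    InF A Θ (LinearMap.ker φ) := by
  have hfin := hE.finite_Θ
  have hU₁ : IsUpperSet {a : Λ | ¬ a < j} := fun a b hab ha hb => ha (hab.trans_lt hb)
  have hU₂ : IsUpperSet {a : Λ | ¬ a ≤ j} := fun a b hab ha hb => ha (hab.trans hb)
  obtain ⟨N, hN, hXN⟩ := hE.exists_submodule_of_isUpperSet hU₁ hX
  have hs : Function.Surjective (φ ∘ₗ N.subtype) := by
    by_contra hs
    have hle : LinearMap.range (φ ∘ₗ N.subtype) ≤ Module.jacobson A (Θ j) :=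
      le_jacobson_of_simple_head (hTop j) fun h => hs (LinearMap.range_eq_top.1 h)
    let ψ : X →ₗ[A] Head A (Θ j) := (Module.jacobson A (Θ j)).mkQ ∘ₗ φ
    have hψs : Function.Surjective ψ := (Submodule.mkQ_surjective _).comp hφ
    have hψN : N ≤ LinearMap.ker ψ := fun x hx =>
      (Submodule.Quotient.mk_eq_zero _).2 (hle ⟨⟨x, hx⟩, rfl⟩)
    have hne : N.liftQ ψ hψN ≠ 0 := by
      intro h0
      have := (hTop j).nontrivial
      obtain ⟨z, hz⟩ := exists_ne (0 : Head A (Θ j))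
      obtain ⟨x, rfl⟩ := hψs z
      exact hz (LinearMap.congr_fun h0 (N.mkQ x))
    have hj := mem_of_hom_head_ne_zero hfin hTop hTop' hXN _ hne
    exact hj.2 (lt_irrefl j)
  refine IsFilteredBy.ker_of_surjective_restrict φ N hs ?_ hXN.inF
  obtain ⟨N', hN', hNN'⟩ := hE.exists_submodule_of_isUpperSet hU₂ hN
  have hle : N' ≤ LinearMap.ker (φ ∘ₗ N.subtype) := by
    have h0 := hom_eq_zero_of_isFilteredBy hE.hom_eq_zero (S' := {j})
      (by rintro s ⟨-, hs⟩ t rfl; exact hs) hN'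
      (IsFilteredBy.of_mem (Set.mem_singleton j) (LinearEquiv.refl A (Θ j)))
      (φ ∘ₗ N.subtype ∘ₗ N'.subtype)
    exact fun x hx => LinearMap.congr_fun h0 ⟨x, hx⟩
  refine IsFilteredBy.ker_of_ker_liftQ _ N' hle hN'.inF ?_
  refine IsFilteredBy.inF (hE.ker_isFilteredBy_singleton hTop (hNN'.mono ?_) _ ?_)
  · rintro a ⟨⟨-, h1⟩, h2⟩
    have h1' : ¬ a < j := h1
    have h2' : a ≤ j := not_not.1 h2
    exact (h2'.lt_or_eq).resolve_left h1'
  · intro z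
    obtain ⟨x, hx⟩ := hs z
    exact ⟨N'.mkQ x, hx⟩

/-- `F(Θ)` is closed under kernels of epimorphisms. -/
theorem inF_ker_of_surjective [IsNoetherianRing A] {X Y : Type u} [AddCommGroup X] [Module A X]
    [AddCommGroup Y] [Module A Y] (hX : InF A Θ X) (hY : InF A Θ Y) (φ : X →ₗ[A] Y)
    (hφ : Function.Surjective φ) : InF A Θ (LinearMap.ker φ) := by
  suffices h : ∀ (X : Type u) [AddCommGroup X] [Module A X] (φ : X →ₗ[A] Y), InF A Θ X →
      Function.Surjective φ → InF A Θ (LinearMap.ker φ) from h X φ hX hφ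
  -- Induct on the filtration of `Y` with `X` varying: the kernel of `X → Y → Θ i` lies in `F(Θ)`,
  -- and it maps onto the smaller module `Y₁` with the same kernel as `φ`.
  refine IsFilteredBy.induction (motive := fun Y _ _ => ∀ (X : Type u) [AddCommGroup X]
    [Module A X] (φ : X →ₗ[A] Y), InF A Θ X → Function.Surjective φ →
    InF A Θ (LinearMap.ker φ)) ?_ ?_ hY
  · intro Y _ _ _ X _ _ φ hX _
    have : LinearMap.ker φ = ⊤ := LinearMap.ker_eq_top.2 (Subsingleton.elim _ _)
    exact IsFilteredBy.of_equiv (LinearEquiv.ofTop _ this).symm hX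
  · intro Y _ _ Y₁ i _ _ ih e X _ _ φ hX hφ
    let ψ : X →ₗ[A] Θ i := e.toLinearMap ∘ₗ Y₁.mkQ ∘ₗ φ
    have hψ : Function.Surjective ψ := e.surjective.comp (Y₁.mkQ_surjective.comp hφ)
    have hkψ := hE.inF_ker_of_surjective_Θ hTop hTop' hX ψ hψ
    have hmem : ∀ x, x ∈ LinearMap.ker ψ ↔ φ x ∈ Y₁ := fun x => by
      rw [LinearMap.ker_comp, LinearEquiv.ker, Submodule.comap_bot, LinearMap.ker_comp,
        Submodule.ker_mkQ]
      rfl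
    let φ' : LinearMap.ker ψ →ₗ[A] Y₁ := φ.restrict fun x hx => (hmem x).1 hx
    have hφ' : Function.Surjective φ' := by
      rintro ⟨y, hy⟩
      obtain ⟨x, rfl⟩ := hφ y
      exact ⟨⟨x, (hmem x).2 hy⟩, rfl⟩
    have h1 := ih _ φ' hkψ hφ'
    have hle : LinearMap.ker φ ≤ LinearMap.ker ψ := fun x hx => by
      rw [hmem, LinearMap.mem_ker.1 hx]
      exact zero_mem _
    refine IsFilteredBy.of_equiv ?_ h1
    refine LinearEquiv.trans (LinearEquiv.ofEq _ ((LinearMap.ker φ).submoduleOf _) ?_)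
      (Submodule.submoduleOfEquivOfLe hle)
    ext x
    rw [LinearMap.mem_ker, Subtype.ext_iff]
    rfl

end IsEPSS

end System

end Modules

/-! ### Relative projective covers and maps to `Θ` -/

section Covers

variable {A : Type u} [Ring A] {Λ : Type u} {Θ : Λ → Type u} [∀ l, AddCommGroup (Θ l)]
  [∀ l, Module A (Θ l)] {Q : Λ → Type u} [∀ l, AddCommGroup (Q l)] [∀ l, Module A (Q l)]

variable (A Θ) in
/-- `P` has the lifting property with respect to epimorphisms with kernel in `F(Θ)`. -/
def IsRelProjective (P : Type u) [AddCommGroup P] [Module A P] : Prop :=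
  ∀ (X Y : Type u) [AddCommGroup X] [Module A X] [AddCommGroup Y] [Module A Y]
    (p : X →ₗ[A] Y), Function.Surjective p → InF A Θ (LinearMap.ker p) →
    ∀ f : P →ₗ[A] Y, ∃ g : P →ₗ[A] X, p ∘ₗ g = f

theorem IsRelProjective.pi {σ : Type*} [Finite σ] {P : σ → Type u} [∀ s, AddCommGroup (P s)]
    [∀ s, Module A (P s)] {P' : Type u} [AddCommGroup P'] [Module A P']
    (e : P' ≃ₗ[A] ∀ s, P s) (h : ∀ s, IsRelProjective A Θ (P s)) : IsRelProjective A Θ P' := by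
  classical
  have := Fintype.ofFinite σ
  intro X Y _ _ _ _ p hp hk f
  choose g hg using fun s => h s X Y p hp hk (f ∘ₗ e.symm.toLinearMap ∘ₗ LinearMap.single A P s)
  refine ⟨(∑ s, g s ∘ₗ LinearMap.proj s) ∘ₗ e.toLinearMap, LinearMap.ext fun x => ?_⟩
  have hg' : ∀ s y, p (g s y) = f (e.symm (Pi.single s y)) := fun s y => LinearMap.congr_fun (hg s) y
  simp only [LinearMap.comp_apply, LinearMap.sum_apply, map_sum, LinearMap.proj_apply, hg']
  rw [← map_sum, ← map_sum, LinearEquiv.coe_coe, Finset.univ_sum_single, e.symm_apply_apply]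

theorem IsRelProjective.of_retract {P P' : Type u} [AddCommGroup P] [Module A P]
    [AddCommGroup P'] [Module A P'] (h : IsRelProjective A Θ P') (i : P →ₗ[A] P') (r : P' →ₗ[A] P)
    (hri : r ∘ₗ i = LinearMap.id) : IsRelProjective A Θ P := by
  intro X Y _ _ _ _ p hp hk f
  obtain ⟨g, hg⟩ := h X Y p hp hk (f ∘ₗ r)
  exact ⟨g ∘ₗ i, by rw [← LinearMap.comp_assoc, hg, LinearMap.comp_assoc, hri, LinearMap.comp_id]⟩

theorem surjective_of_le_jacobson {M P : Type*} [AddCommGroup M] [Module A M] [Module.Finite A M]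
    [AddCommGroup P] [Module A P] {N : Submodule A M} (hN : N ≤ Module.jacobson A M)
    (p : P →ₗ[A] M) (hp : Function.Surjective (N.mkQ ∘ₗ p)) : Function.Surjective p := by
  rw [← LinearMap.range_eq_top]
  by_contra hne
  obtain h1 | ⟨T, hT, hle⟩ := eq_top_or_exists_le_coatom (LinearMap.range p)
  · exact hne h1
  · refine hT.1 (eq_top_iff.2 fun x _ => ?_)
    obtain ⟨y, hy⟩ := hp (N.mkQ x)
    have hy' : N.mkQ (x - p y) = 0 := by
      rw [map_sub, sub_eq_zero]; exact hy.symm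
    have h2 : x - p y ∈ T := (hN.trans (sInf_le hT)) ((Submodule.Quotient.mk_eq_zero _).1 hy')
    have := T.add_mem h2 (hle ⟨y, rfl⟩)
    rwa [sub_add_cancel] at this

/-- The induced epimorphism of heads composes with the given isomorphism to a surjective
endomorphism of a Noetherian module. It is therefore injective, so an element of `N`, having zero
image, lies in the radical. -/
theorem le_jacobson_of_head_equiv {M T : Type*} [AddCommGroup M] [Module A M] [IsNoetherian A M]
    [AddCommGroup T] [Module A T] {N : Submodule A M} (e : (M ⧸ N) ≃ₗ[A] T)
    (e' : Head A M ≃ₗ[A] Head A T) : N ≤ Module.jacobson A M := by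
  let q : M →ₗ[A] T := e.toLinearMap ∘ₗ N.mkQ
  have hq : Function.Surjective q := e.surjective.comp N.mkQ_surjective
  let q' : Head A M →ₗ[A] Head A T :=
    (Module.jacobson A M).mapQ (Module.jacobson A T) q (Module.le_comap_jacobson q)
  have hq' : Function.Surjective q' := by
    intro y
    obtain ⟨y, rfl⟩ := Submodule.mkQ_surjective _ y
    obtain ⟨x, rfl⟩ := hq y
    exact ⟨(Module.jacobson A M).mkQ x, rfl⟩
  have hinj : Function.Injective (e'.symm.toLinearMap ∘ₗ q') :=
    IsNoetherian.injective_of_surjective_endomorphism _ (e'.symm.surjective.comp hq')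
  intro x hx
  have h1 : q x = 0 := by
    have : N.mkQ x = 0 := (Submodule.Quotient.mk_eq_zero _).2 hx
    simp [q, this]
  have h2 : q' ((Module.jacobson A M).mkQ x) = 0 := by
    change (Module.jacobson A T).mkQ (q x) = 0
    rw [h1, map_zero]
  have h3 : (Module.jacobson A M).mkQ x = 0 := by
    apply hinj
    rw [LinearMap.comp_apply, h2, map_zero, map_zero]
  exact (Submodule.Quotient.mk_eq_zero _).1 h3

/-- Replaces the multiplicities by one finite family `c`, so that the top layer is a single product.
-/
theorem IsGeneratedInHeight.exists_top [Fintype Λ] [PartialOrder Λ] {i : ℕ} {M : Type u}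
    [AddCommGroup M] [Module A M] (h : IsGeneratedInHeight A Θ i M) :
    ∃ (N : Submodule A M) (σ : Type u) (_ : Finite σ) (c : σ → Λ),
      (∀ s, height (c s) = i) ∧ IsFilteredBy A Θ {l | i < height l} N ∧
      Nonempty ((M ⧸ N) ≃ₗ[A] ∀ s, Θ (c s)) ∧
      Nonempty (Head A M ≃ₗ[A] Head A (∀ s, Θ (c s))) := by
  obtain ⟨N, m, hN, ⟨e⟩, ⟨e'⟩⟩ := h
  let c : (Σ l : {l : Λ // height l = i}, Fin (m l)) → Λ := fun s => s.1
  let φ : (∀ s, Θ (c s)) ≃ₗ[A] (∀ l : {l : Λ // height l = i}, Fin (m l) → Θ l) :=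
    LinearEquiv.piCurry A fun (l : {l : Λ // height l = i}) (_ : Fin (m l)) => Θ l
  have hφ : (Module.jacobson A (∀ l : {l : Λ // height l = i}, Fin (m l) → Θ l)).map
      φ.symm.toLinearMap = Module.jacobson A (∀ s, Θ (c s)) :=
    Module.map_jacobson_of_bijective φ.symm.bijective
  exact ⟨N, _, inferInstance, c, fun s => s.1.2, hN, ⟨e.trans φ.symm⟩,
    ⟨e'.trans (Submodule.Quotient.equiv _ _ φ.symm hφ)⟩⟩

variable [Fintype Λ] [PartialOrder Λ]

theorem IsGeneratedInHeight.inF {i : ℕ} {M : Type u}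
    [AddCommGroup M] [Module A M] (h : IsGeneratedInHeight A Θ i M) : InF A Θ M := by
  obtain ⟨N, σ, _, c, -, hN, ⟨e⟩, -⟩ := h.exists_top
  exact IsFilteredBy.of_submodule_quotient (IsFilteredBy.pi (S := Set.univ) fun s =>
    IsFilteredBy.of_mem (Set.mem_univ (c s)) (LinearEquiv.refl A (Θ (c s)))) N hN.inF e

namespace IsEPSS

variable (hE : IsEPSS A Θ Q)
include hE

theorem isRelProjective (l : Λ) : IsRelProjective A Θ (Q l) :=
  fun _ _ _ _ _ _ p hp hk f => hE.exists_lift p hp hk l f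

theorem isRelProjective_of_inAdd {P : Type u} [AddCommGroup P] [Module A P]
    (hP : InAdd A Q P) : IsRelProjective A Θ P := by
  obtain ⟨n, i, r, h⟩ := hP
  refine IsRelProjective.of_retract ?_ i r h
  exact IsRelProjective.pi (LinearEquiv.refl A _) fun _ =>
    IsRelProjective.pi (LinearEquiv.refl A _) hE.isRelProjective

theorem inF_Q (l : Λ) : InF A Θ (Q l) := by
  obtain ⟨p, hp, hk⟩ := hE.exact l
  exact IsFilteredBy.of_submodule_quotient (IsFilteredBy.of_mem (Set.mem_univ l)
    (LinearEquiv.refl A (Θ l))) _ hk.inF (p.quotKerEquivOfSurjective hp)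

/-- This is where `Hom(Q, Θ) ≅ Hom(Θ, Θ)` enters. Precomposition with `Q → Θ` is an injective
`End(Θ)`-linear map between these modules; over an Artinian ring an abstract isomorphism makes it
surjective. Hence every map `Q l → Θ` vanishes on `K l`. -/
theorem exists_cover [IsArtinianRing (Module.End A (∀ l, Θ l))]
    (hHom : Nonempty (((∀ l, Q l) →ₗ[A] (∀ l, Θ l)) ≃ₗ[Module.End A (∀ l, Θ l)]
      ((∀ l, Θ l) →ₗ[A] (∀ l, Θ l)))) :
    ∃ p : ∀ l, Q l →ₗ[A] Θ l, ∀ l, Function.Surjective (p l) ∧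
      ∀ f : Q l →ₗ[A] (∀ l, Θ l), LinearMap.ker (p l) ≤ LinearMap.ker f := by
  classical
  obtain ⟨e⟩ := hHom
  choose p hp _ using hE.exact
  refine ⟨p, fun l => ⟨hp l, fun f x hx => ?_⟩⟩
  let P : (∀ l, Q l) →ₗ[A] (∀ l, Θ l) := LinearMap.pi fun l => p l ∘ₗ LinearMap.proj l
  have hP : Function.Surjective P := fun y =>
    ⟨fun l => (hp l (y l)).choose, funext fun l => (hp l (y l)).choose_spec⟩
  let F : ((∀ l, Θ l) →ₗ[A] (∀ l, Θ l)) →ₗ[Module.End A (∀ l, Θ l)]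
      ((∀ l, Q l) →ₗ[A] (∀ l, Θ l)) :=
    { toFun := fun g => g ∘ₗ P
      map_add' := fun _ _ => rfl
      map_smul' := fun _ _ => rfl }
  have hF : Function.Injective F := fun g g' h => LinearMap.ext fun y => by
    obtain ⟨x, rfl⟩ := hP y
    exact LinearMap.congr_fun h x
  have : IsArtinian (Module.End A (∀ l, Θ l)) ((∀ l, Θ l) →ₗ[A] (∀ l, Θ l)) :=
    inferInstanceAs (IsArtinian (Module.End A (∀ l, Θ l)) (Module.End A (∀ l, Θ l)))
  have hs : Function.Surjective (e.toLinearMap ∘ₗ F) :=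
    IsArtinian.surjective_of_injective_endomorphism _ (e.injective.comp hF)
  obtain ⟨g, hg⟩ := hs (e (f ∘ₗ LinearMap.proj l))
  have hg' : g ∘ₗ P = f ∘ₗ LinearMap.proj l := e.injective hg
  have h1 : P (Pi.single l x) = 0 := by
    ext m
    by_cases hm : m = l
    · subst hm
      simpa [P] using hx
    · simp [P, Pi.single_eq_of_ne hm]
  have h2 := LinearMap.congr_fun hg' (Pi.single l x)
  rw [LinearMap.comp_apply, h1, map_zero] at h2
  simpa using h2.symm

variable [IsNoetherianRing A] [IsArtinianRing (Module.End A (∀ l, Θ l))]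
  (hHom : Nonempty (((∀ l, Q l) →ₗ[A] (∀ l, Θ l)) ≃ₗ[Module.End A (∀ l, Θ l)]
      ((∀ l, Θ l) →ₗ[A] (∀ l, Θ l))))
include hHom

/-- Lift the projection from the sum of the `Q (c s)` onto the top layer through `M`. The lift is
onto because `N` lies in the radical of `M`, and maps to `Θ` see only the top layer by
`exists_cover`. -/
theorem exists_cover_of_top {M : Type u} [AddCommGroup M] [Module A M] {N : Submodule A M}
    (hN : InF A Θ N) {σ : Type u} [Finite σ] {c : σ → Λ} (e : (M ⧸ N) ≃ₗ[A] ∀ s, Θ (c s))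
    (e' : Head A M ≃ₗ[A] Head A (∀ s, Θ (c s))) :
    ∃ p : (∀ s, Q (c s)) →ₗ[A] M, Function.Surjective p ∧
      ∀ f : (∀ s, Q (c s)) →ₗ[A] (∀ l, Θ l), LinearMap.ker (N.mkQ ∘ₗ p) ≤ LinearMap.ker f := by
  classical
  have := Fintype.ofFinite σ
  obtain ⟨p, hp⟩ := hE.exists_cover hHom
  have hM : InF A Θ M := IsFilteredBy.of_submodule_quotient (IsFilteredBy.pi (S := Set.univ)
    fun s => IsFilteredBy.of_mem (Set.mem_univ (c s)) (LinearEquiv.refl A (Θ (c s)))) N hN e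
  have : Module.Finite A M := IsFilteredBy.finite hE.finite_Θ hM
  let P : (∀ s, Q (c s)) →ₗ[A] (∀ s, Θ (c s)) :=
    LinearMap.pi fun s => p (c s) ∘ₗ LinearMap.proj s
  have hP : Function.Surjective P := fun y =>
    ⟨fun s => ((hp (c s)).1 (y s)).choose, funext fun s => ((hp (c s)).1 (y s)).choose_spec⟩
  have hrel : IsRelProjective A Θ (∀ s, Q (c s)) :=
    IsRelProjective.pi (LinearEquiv.refl A _) fun s => hE.isRelProjective (c s)
  obtain ⟨q, hq⟩ := hrel M (M ⧸ N) N.mkQ N.mkQ_surjective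
    (by rw [Submodule.ker_mkQ]; exact hN) (e.symm.toLinearMap ∘ₗ P)
  refine ⟨q, surjective_of_le_jacobson (le_jacobson_of_head_equiv e e') q ?_, ?_⟩
  · rw [hq]
    exact e.symm.surjective.comp hP
  · intro f x hx
    have hx' : P x = 0 := by
      rw [hq, LinearMap.mem_ker] at hx
      exact (e.symm.map_eq_zero_iff).1 hx
    rw [LinearMap.mem_ker, ← Finset.univ_sum_single x, map_sum]
    refine Finset.sum_eq_zero fun s _ => ?_
    exact (hp (c s)).2 (f ∘ₗ LinearMap.single A (fun s => Q (c s)) s) (congrFun hx' s)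

/-- Maps to `Θ` factor through the top of a module generated in one height. -/
theorem le_ker_of_top {M : Type u} [AddCommGroup M] [Module A M] {N : Submodule A M}
    (hN : InF A Θ N) {σ : Type u} [Finite σ] {c : σ → Λ} (e : (M ⧸ N) ≃ₗ[A] ∀ s, Θ (c s))
    (e' : Head A M ≃ₗ[A] Head A (∀ s, Θ (c s))) (f : M →ₗ[A] (∀ l, Θ l)) :
    N ≤ LinearMap.ker f := by
  obtain ⟨p, hp, hk⟩ := hE.exists_cover_of_top hHom hN e e'
  intro x hx
  obtain ⟨y, rfl⟩ := hp x
  exact hk (f ∘ₗ p) ((Submodule.Quotient.mk_eq_zero _).2 hx)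

/-- If `M` is generated in one height, then every map from its relative projective cover to `Θ`
factors through `M`. -/
theorem ker_le_ker_of_isRelProjCover (hTop : ∀ l, IsSimpleModule A (Head A (Θ l)))
    (hTop' : ∀ l m, l ≠ m → IsEmpty (Head A (Θ l) ≃ₗ[A] Head A (Θ m))) {i : ℕ}
    {M P : Type u} [AddCommGroup M] [Module A M] [AddCommGroup P] [Module A P]
    (hM : IsGeneratedInHeight A Θ i M) {p : P →ₗ[A] M} (hp : IsRelProjCover A Θ Q p)
    (f : P →ₗ[A] (∀ l, Θ l)) : LinearMap.ker p ≤ LinearMap.ker f := by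
  obtain ⟨N, σ, _, c, -, hN, ⟨e⟩, ⟨e'⟩⟩ := hM.exists_top
  obtain ⟨q, hq, hqk⟩ := hE.exists_cover_of_top hHom hN.inF e e'
  have hrel : IsRelProjective A Θ (∀ s, Q (c s)) :=
    IsRelProjective.pi (LinearEquiv.refl A _) fun s => hE.isRelProjective (c s)
  -- Compare `p` with the explicit cover `q` in both directions. Lifting `p` through `q` needs the
  -- kernel of `q` in `F(Θ)`; right minimality of `p` makes `a ∘ b` bijective, so the vanishing for
  -- `q` transfers to `p`.
  obtain ⟨a, ha⟩ := hrel P M p hp.surjective hp.ker_inF q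
  obtain ⟨b, hb⟩ := hE.isRelProjective_of_inAdd hp.inAdd (∀ s, Q (c s)) M q hq
    (hE.inF_ker_of_surjective hTop hTop' (IsFilteredBy.pi fun s => hE.inF_Q (c s)) hM.inF q hq) p
  have hab := hp.minimal (a ∘ₗ b) (by rw [← LinearMap.comp_assoc, ha, hb])
  intro x hx
  obtain ⟨y, rfl⟩ := hab.2 x
  refine hqk (f ∘ₗ a) (x := b y) ?_
  have h1 : q (b y) = 0 := by
    rw [← ha]
    exact hx
  rw [LinearMap.mem_ker, LinearMap.comp_apply, h1, map_zero]

end IsEPSS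

end Covers

/-! ### `Extⁿ(X, Θ)` as a module over the diagonal algebra -/

section ExtModule

open Abelian

variable {A : Type u} [Ring A] {Λ : Type u} (Θ : Λ → Type u) [∀ l, AddCommGroup (Θ l)]
  [∀ l, Module A (Θ l)]

variable (A) in
/-- The algebra `⨁ End(Θ l)`. -/
abbrev DiagEnd : Type u := ∀ l, Module.End A (Θ l)

variable (A) in
/-- The module `⨁ Θ l`. -/
abbrev total : ModuleCat.{u} A := ModuleCat.of A (∀ l, Θ l)

variable {Θ} in
/-- The endomorphism of `⨁ Θ l` in degree zero given by a family of endomorphisms. -/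
noncomputable abbrev diagExt (d : DiagEnd A Θ) : Ext (total A Θ) (total A Θ) 0 :=
  Ext.mk₀ (ModuleCat.ofHom (diagEnd A Θ d))

/-- `⨁ End(Θ l)` acts on `Extⁿ(X, ⨁ Θ l)` by postcomposition. -/
noncomputable instance extDiagModule (X : ModuleCat.{u} A) (n : ℕ) :
    Module (DiagEnd A Θ) (Ext X (total A Θ) n) where
  smul d x := x.comp (diagExt d) (add_zero n)
  one_smul x := by
    change x.comp (Ext.mk₀ (𝟙 _)) (add_zero n) = x
    exact Ext.comp_mk₀_id x
  mul_smul d d' x := by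
    change x.comp (diagExt (d * d')) (add_zero n) =
      (x.comp (diagExt d') (add_zero n)).comp (diagExt d) (add_zero n)
    rw [Ext.comp_assoc_of_third_deg_zero, Ext.mk₀_comp_mk₀]
    rfl
  smul_zero d := Ext.zero_comp _ _ _ _ _
  smul_add d x y := Ext.add_comp _ _ _ _
  add_smul d d' x := by
    change x.comp (Ext.mk₀ (ModuleCat.ofHom (diagEnd A Θ (d + d')))) (add_zero n) = _
    rw [map_add]
    change x.comp (Ext.mk₀ (ModuleCat.ofHom (diagEnd A Θ d) + ModuleCat.ofHom (diagEnd A Θ d')))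
      (add_zero n) = _
    rw [Ext.mk₀_add, Ext.comp_add]
    rfl
  zero_smul x := by
    change x.comp (Ext.mk₀ (0 : total A Θ ⟶ total A Θ)) (add_zero n) = 0
    rw [Ext.mk₀_zero, Ext.comp_zero]

variable {Θ}

theorem extDiag_smul_def {X : ModuleCat.{u} A} {n : ℕ} (d : DiagEnd A Θ)
    (x : Ext X (total A Θ) n) : d • x = x.comp (diagExt d) (add_zero n) := rfl

variable (Θ) in
/-- Precomposition with an extension, as a linear map. -/
noncomputable def extPrecomp {X X' : ModuleCat.{u} A} {p : ℕ} (y : Ext X X' p) (n m : ℕ)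
    (h : p + n = m) : Ext X' (total A Θ) n →ₗ[DiagEnd A Θ] Ext X (total A Θ) m where
  toFun x := y.comp x h
  map_add' _ _ := Ext.comp_add _ _ _ _
  map_smul' d x := by
    rw [RingHom.id_apply, extDiag_smul_def, extDiag_smul_def, Ext.comp_assoc_of_third_deg_zero]

theorem sum_comp_comp {C : Type*} [Category* C] [Abelian C] [HasExt.{v} C] {σ : Type*}
    [Fintype σ] {X Y : C} {Z : σ → C} (b : ∀ s, X ⟶ Z s) (a : ∀ s, Z s ⟶ X)
    (h : ∑ s, b s ≫ a s = 𝟙 X) {n : ℕ} (x : Ext X Y n) :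
    ∑ s, (Ext.mk₀ (b s)).comp ((Ext.mk₀ (a s)).comp x (zero_add n)) (zero_add n) = x := by
  simp only [Ext.mk₀_comp_mk₀_assoc]
  rw [← Ext.sum_comp, ← Ext.mk₀_sum, h, Ext.mk₀_id_comp]

theorem subsingleton_ext_of_sum {C : Type*} [Category* C] [Abelian C] [HasExt.{v} C] {σ : Type*}
    [Fintype σ] {X Y : C} {Z : σ → C} (b : ∀ s, X ⟶ Z s) (a : ∀ s, Z s ⟶ X)
    (h : ∑ s, b s ≫ a s = 𝟙 X) {n : ℕ} (hZ : ∀ s, Subsingleton (Ext (Z s) Y n)) :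
    Subsingleton (Ext X Y n) := by
  refine subsingleton_of_forall_eq 0 fun x => ?_
  rw [← sum_comp_comp b a h x]
  refine Finset.sum_eq_zero fun s _ => ?_
  rw [Subsingleton.elim ((Ext.mk₀ (a s)).comp x (zero_add n)) 0, Ext.comp_zero]

variable (Θ) in
/-- `Extⁿ(X, ⨁ Θ l)` is a finitely generated projective module over `⨁ End(Θ l)`. -/
def IsExtFinProj (X : ModuleCat.{u} A) (n : ℕ) : Prop :=
  Module.Finite (DiagEnd A Θ) (Ext X (total A Θ) n) ∧
    Module.Projective (DiagEnd A Θ) (Ext X (total A Θ) n)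

theorem finite_and_projective_of_sum {D : Type*} [Ring D] {σ : Type*} [Fintype σ] {P : σ → Type*}
    [∀ l, AddCommGroup (P l)] [∀ l, Module D (P l)]
    (hP : ∀ l, Module.Finite D (P l) ∧ Module.Projective D (P l))
    {M : Type*} [AddCommGroup M] [Module D M]
    (i : ∀ l, M →ₗ[D] P l) (r : ∀ l, P l →ₗ[D] M) (h : ∀ x, ∑ l, r l (i l x) = x) :
    Module.Finite D M ∧ Module.Projective D M := by
  classical
  have hf : ∀ l, Module.Finite D (P l) := fun l => (hP l).1
  have hp : ∀ l, Module.Projective D (P l) := fun l => (hP l).2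
  constructor
  · refine Module.Finite.of_surjective (∑ l, r l ∘ₗ LinearMap.proj l : (∀ l, P l) →ₗ[D] M)
      fun x => ⟨fun l => i l x, ?_⟩
    simpa using h x
  · refine Module.Projective.of_split (M := Π₀ l, P l)
      ((DFinsupp.linearEquivFunOnFintype (R := D)).symm.toLinearMap ∘ₗ LinearMap.pi i)
      (DFinsupp.lsum ℕ r) (LinearMap.ext fun x => ?_)
    conv_rhs => rw [LinearMap.id_apply, ← h x]
    simp only [LinearMap.comp_apply, DFinsupp.lsum_apply_apply, DFinsupp.sumAddHom_apply]
    rw [DFinsupp.sum_eq_sum_fintype]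
    · rfl
    · intro l; exact map_zero (r l)

theorem IsExtFinProj.of_sum {σ : Type*} [Fintype σ] {X : ModuleCat.{u} A}
    {Z : σ → ModuleCat.{u} A} (b : ∀ s, X ⟶ Z s) (a : ∀ s, Z s ⟶ X)
    (h : ∑ s, b s ≫ a s = 𝟙 X) {n : ℕ} (hZ : ∀ s, IsExtFinProj Θ (Z s) n) :
    IsExtFinProj Θ X n :=
  finite_and_projective_of_sum hZ (fun s => extPrecomp Θ (Ext.mk₀ (a s)) n n (zero_add n))
    (fun s => extPrecomp Θ (Ext.mk₀ (b s)) n n (zero_add n)) (sum_comp_comp b a h)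

theorem IsExtFinProj.of_bijective {X X' : ModuleCat.{u} A} {p n m : ℕ} (y : Ext X X' p)
    (h : p + n = m) (hy : Function.Bijective (extPrecomp Θ y n m h)) (hX : IsExtFinProj Θ X' n) :
    IsExtFinProj Θ X m := by
  obtain ⟨h1, h2⟩ := hX
  exact ⟨Module.Finite.equiv (LinearEquiv.ofBijective _ hy),
    Module.Projective.of_equiv (LinearEquiv.ofBijective _ hy)⟩

theorem bijective_extPrecomp_iso {X X' : ModuleCat.{u} A} (e : X ≅ X') (n : ℕ) :
    Function.Bijective (extPrecomp Θ (Ext.mk₀ e.hom) n n (zero_add n)) := by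
  refine Function.bijective_iff_has_inverse.2
    ⟨extPrecomp Θ (Ext.mk₀ e.inv) n n (zero_add n), fun x => ?_, fun x => ?_⟩
  · change (Ext.mk₀ e.inv).comp ((Ext.mk₀ e.hom).comp x (zero_add n)) (zero_add n) = x
    rw [Ext.mk₀_comp_mk₀_assoc, e.inv_hom_id, Ext.mk₀_id_comp]
  · change (Ext.mk₀ e.hom).comp ((Ext.mk₀ e.inv).comp x (zero_add n)) (zero_add n) = x
    rw [Ext.mk₀_comp_mk₀_assoc, e.hom_inv_id, Ext.mk₀_id_comp]

/-- Dimension shift by the long exact sequence. The hypothesis `h0` only asks that restriction from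
the middle term be zero, so that degree `n = 0`, where `Ext S.X₂` need not vanish, is covered as
well. -/
theorem bijective_extPrecomp_extClass {S : ShortComplex (ModuleCat.{u} A)} (hS : S.ShortExact)
    {n m : ℕ} (h : 1 + n = m)
    (h0 : ∀ x : Ext S.X₂ (total A Θ) n, (Ext.mk₀ S.f).comp x (zero_add n) = 0)
    (h1 : Subsingleton (Ext S.X₂ (total A Θ) m)) :
    Function.Bijective (extPrecomp Θ hS.extClass n m h) := by
  constructor
  · rw [← LinearMap.ker_eq_bot, eq_bot_iff]
    intro x hx
    obtain ⟨y, rfl⟩ := Ext.contravariant_sequence_exact₁ hS _ x h hx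
    exact h0 y
  · intro x
    exact Ext.contravariant_sequence_exact₃ hS _ x (Subsingleton.elim _ _) h

theorem subsingleton_ext_of_isFilteredBy {S : Set Λ} {Y : ModuleCat.{u} A} {n : ℕ}
    (hS : ∀ s ∈ S, Subsingleton (Ext (ModuleCat.of A (Θ s)) Y n)) {M : Type u} [AddCommGroup M]
    [Module A M] (h : IsFilteredBy A Θ S M) : Subsingleton (Ext (ModuleCat.of A M) Y n) := by
  refine IsFilteredBy.induction
    (motive := fun M _ _ => Subsingleton (Ext (ModuleCat.of A M) Y n)) ?_ ?_ h
  · intro M _ _ hM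
    refine subsingleton_of_forall_eq 0 fun x => ?_
    rw [← Ext.mk₀_id_comp x, show 𝟙 (ModuleCat.of A M) = 0 from
      ModuleCat.hom_ext (LinearMap.ext fun _ => Subsingleton.elim _ _), Ext.mk₀_zero,
      Ext.zero_comp]
  · intro M _ _ N i hi _ hN e
    let g : M →ₗ[A] Θ i := e.toLinearMap ∘ₗ N.mkQ
    have hg : Function.Surjective g := e.surjective.comp N.mkQ_surjective
    have hk : LinearMap.ker g = N := by rw [LinearEquiv.ker_comp, Submodule.ker_mkQ]
    have hi' := hS i hi
    have hk' : Subsingleton (Ext (ModuleCat.of A (LinearMap.ker g)) Y n) := by rw [hk]; exact hN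
    refine subsingleton_of_forall_eq 0 fun x => ?_
    obtain ⟨y, rfl⟩ := Ext.contravariant_sequence_exact₂ (LinearMap.shortExact_shortComplexKer hg)
      Y x (Subsingleton.elim (h := hk') _ _)
    rw [Subsingleton.elim (h := hi') y 0, Ext.comp_zero]

end ExtModule

/-! ### Vanishing of extensions and dimension shifting along syzygies -/

section Vanishing

open Abelian

variable {A : Type u} [Ring A] {Λ : Type u} {Θ : Λ → Type u} [∀ l, AddCommGroup (Θ l)]
  [∀ l, Module A (Θ l)] {Q : Λ → Type u} [∀ l, AddCommGroup (Q l)] [∀ l, Module A (Q l)]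


theorem subsingleton_ext_of_inAdd [Finite Λ] {Y : ModuleCat.{u} A} {n : ℕ}
    (h : Subsingleton (Ext (ModuleCat.of A (∀ l, Q l)) Y n)) {P : Type u} [AddCommGroup P]
    [Module A P] (hP : InAdd A Q P) : Subsingleton (Ext (ModuleCat.of A P) Y n) := by
  obtain ⟨m, i, r, hri⟩ := hP
  refine subsingleton_ext_of_sum (σ := Fin m) (X := ModuleCat.of A P)
    (Z := fun _ => ModuleCat.of A (∀ l, Q l))
    (fun j => ModuleCat.ofHom (LinearMap.proj j ∘ₗ i))
    (fun j => ModuleCat.ofHom (r ∘ₗ LinearMap.single A (fun _ => ∀ l, Q l) j)) ?_ (fun _ => h)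
  refine ModuleCat.hom_ext (LinearMap.ext fun x => ?_)
  have h1 : r (∑ j, Pi.single j (i x j)) = x := by
    rw [Finset.univ_sum_single]
    exact LinearMap.congr_fun hri x
  rw [ModuleCat.hom_sum, LinearMap.sum_apply]
  rw [map_sum] at h1
  exact h1

theorem subsingleton_ext_Q [Finite Λ] {Y : ModuleCat.{u} A} {n : ℕ}
    (h : Subsingleton (Ext (ModuleCat.of A (∀ l, Q l)) Y n)) (l : Λ) :
    Subsingleton (Ext (ModuleCat.of A (Q l)) Y n) := by
  classical
  refine subsingleton_ext_of_sum (σ := Unit) (X := ModuleCat.of A (Q l))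
    (Z := fun _ => ModuleCat.of A (∀ l, Q l))
    (fun _ => ModuleCat.ofHom (LinearMap.single A Q l))
    (fun _ => ModuleCat.ofHom (LinearMap.proj l)) ?_ (fun _ => h)
  refine ModuleCat.hom_ext (LinearMap.ext fun x => ?_)
  simp

theorem subsingleton_ext_total [DecidableEq Λ] {X : ModuleCat.{u} A} {n : ℕ}
    (h : Subsingleton (Ext X (ModuleCat.of A (∀ l, Θ l)) n)) (m : Λ) :
    Subsingleton (Ext X (ModuleCat.of A (Θ m)) n) := by
  refine subsingleton_of_forall_eq 0 fun x => ?_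
  have h1 : (ModuleCat.ofHom (LinearMap.single A Θ m) : ModuleCat.of A (Θ m) ⟶ _) ≫
      ModuleCat.ofHom (LinearMap.proj m) = 𝟙 (ModuleCat.of A (Θ m)) :=
    ModuleCat.hom_ext (LinearMap.ext fun x => by simp)
  rw [← Ext.comp_mk₀_id x, ← h1, ← Ext.mk₀_comp_mk₀, ← Ext.comp_assoc_of_third_deg_zero,
    Subsingleton.elim (h := h) (x.comp _ _) 0, Ext.zero_comp]

variable [Fintype Λ] [PartialOrder Λ]

/-- Because `Ext^(n+1)(Q l, Θ m) = 0`, the group `Ext^(n+1)(Θ l, Θ m)` is a quotient of `Ext^n(K l,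
Θ m)`, and the factors of `K l` lie strictly above `l`. The two statements thus feed each other in
the induction. -/
theorem IsEPSS.subsingleton_ext (hE : IsEPSS A Θ Q)
    (hExt : ∀ s : ℕ, 1 ≤ s →
      Subsingleton (Ext (ModuleCat.of A (∀ l, Q l)) (ModuleCat.of A (∀ l, Θ l)) s)) (n : ℕ) :
    (∀ l m, ¬ l ≤ m → Subsingleton (Ext (ModuleCat.of A (Θ l)) (ModuleCat.of A (Θ m)) n)) ∧
    ∀ l m, ¬ l < m → Subsingleton (Ext (ModuleCat.of A (Θ l)) (ModuleCat.of A (Θ m)) (n + 1)) := by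
  classical
  have hstep : ∀ n, (∀ l m, ¬ l ≤ m →
      Subsingleton (Ext (ModuleCat.of A (Θ l)) (ModuleCat.of A (Θ m)) n)) →
      ∀ l m, ¬ l < m →
        Subsingleton (Ext (ModuleCat.of A (Θ l)) (ModuleCat.of A (Θ m)) (n + 1)) := by
    intro n hn l m hlm
    obtain ⟨p, hp, hk⟩ := hE.exact l
    have h1 : Subsingleton (Ext (ModuleCat.of A (LinearMap.ker p)) (ModuleCat.of A (Θ m)) n) :=
      subsingleton_ext_of_isFilteredBy (fun s (hs : l < s) => hn s m fun h => hlm (hs.trans_le h)) hk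
    have h2 : Subsingleton (Ext (ModuleCat.of A (Q l)) (ModuleCat.of A (Θ m)) (n + 1)) :=
      subsingleton_ext_Q (subsingleton_ext_total (hExt (n + 1) (by omega)) m) l
    refine subsingleton_of_forall_eq 0 fun x => ?_
    obtain ⟨y, rfl⟩ := Ext.contravariant_sequence_exact₃ (LinearMap.shortExact_shortComplexKer hp)
      (ModuleCat.of A (Θ m)) x (Subsingleton.elim (h := h2) _ _) (add_comm 1 n)
    rw [Subsingleton.elim (h := h1) y 0, Ext.comp_zero]
  induction n with
  | zero =>
    have h0 : ∀ l m, ¬ l ≤ m →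
        Subsingleton (Ext (ModuleCat.of A (Θ l)) (ModuleCat.of A (Θ m)) 0) := by
      intro l m hlm
      refine subsingleton_of_forall_eq 0 fun x => ?_
      obtain ⟨f, rfl⟩ := (Ext.mk₀_bijective _ _).2 x
      rw [Ext.mk₀_eq_zero_iff]
      exact ModuleCat.hom_ext (hE.hom_eq_zero l m hlm f.hom)
    exact ⟨h0, hstep 0 h0⟩
  | succ n ih =>
    have h0 : ∀ l m, ¬ l ≤ m →
        Subsingleton (Ext (ModuleCat.of A (Θ l)) (ModuleCat.of A (Θ m)) (n + 1)) :=
      fun l m h => ih.2 l m fun h' => h h'.le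
    exact ⟨h0, hstep _ h0⟩

/-- By induction `Ext^n(K 0, Θ) ≅ Hom(K n, Θ)`. Maps out of `K n` factor through its top layer, a
finite sum of `Θ`'s, so the degree zero hypothesis `hb` passes to every degree. -/
theorem IsEPSS.isExtFinProj_syzygy (hE : IsEPSS A Θ Q) [IsNoetherianRing A]
    [IsArtinianRing (Module.End A (∀ l, Θ l))]
    (hExt : ∀ s : ℕ, 1 ≤ s →
      Subsingleton (Ext (ModuleCat.of A (∀ l, Q l)) (ModuleCat.of A (∀ l, Θ l)) s))
    (hTop : ∀ l, IsSimpleModule A (Head A (Θ l)))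
    (hTop' : ∀ l m, l ≠ m → IsEmpty (Head A (Θ l) ≃ₗ[A] Head A (Θ m)))
    (hHom : Nonempty (((∀ l, Q l) →ₗ[A] (∀ l, Θ l)) ≃ₗ[Module.End A (∀ l, Θ l)]
      ((∀ l, Θ l) →ₗ[A] (∀ l, Θ l))))
    (hb : IsExtFinProj Θ (total A Θ) 0) (n : ℕ) (i : ℕ) (K : ℕ → ModuleCat.{u} A)
    (hK : ∀ s, IsRelSyzygy A Θ Q (K s) (K (s + 1)))
    (hgen : ∀ s, IsGeneratedInHeight A Θ (i + s) (K s)) :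
    IsExtFinProj Θ (K 0) n ∧ (Subsingleton (K n) → Subsingleton (Ext (K 0) (total A Θ) n)) := by
  classical
  induction n generalizing i K with
  | zero =>
    constructor
    · obtain ⟨N, σ, _, c, -, hN, ⟨e⟩, ⟨e'⟩⟩ := (hgen 0).exists_top
      have := Fintype.ofFinite σ
      let q : K 0 ⟶ ModuleCat.of A (∀ s, Θ (c s)) := ModuleCat.ofHom (e.toLinearMap ∘ₗ N.mkQ)
      have hq : Function.Surjective q := e.surjective.comp N.mkQ_surjective
      refine IsExtFinProj.of_bijective (Ext.mk₀ q) (zero_add 0) ⟨?_, ?_⟩ ?_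
      · rw [← LinearMap.ker_eq_bot, eq_bot_iff]
        intro x hx
        obtain ⟨f, rfl⟩ := (Ext.mk₀_bijective _ _).2 x
        have hx' : (Ext.mk₀ q).comp (Ext.mk₀ f) (zero_add 0) = 0 := hx
        rw [Ext.mk₀_comp_mk₀, Ext.mk₀_eq_zero_iff] at hx'
        rw [Submodule.mem_bot, Ext.mk₀_eq_zero_iff]
        refine ModuleCat.hom_ext (LinearMap.ext fun y => ?_)
        obtain ⟨z, rfl⟩ := hq y
        exact LinearMap.congr_fun (congrArg ModuleCat.Hom.hom hx') z
      · intro x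
        obtain ⟨f, rfl⟩ := (Ext.mk₀_bijective _ _).2 x
        have hle : LinearMap.ker (e.toLinearMap ∘ₗ N.mkQ) ≤ LinearMap.ker f.hom := by
          rw [LinearEquiv.ker_comp, Submodule.ker_mkQ]
          exact hE.le_ker_of_top hHom hN.inF e e' f.hom
        obtain ⟨g, hg⟩ := exists_factor _ hq f.hom hle
        refine ⟨Ext.mk₀ (ModuleCat.ofHom g), ?_⟩
        change (Ext.mk₀ q).comp (Ext.mk₀ (ModuleCat.ofHom g)) (zero_add 0) = _
        rw [Ext.mk₀_comp_mk₀]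
        congr 1
        exact ModuleCat.hom_ext hg
      · refine IsExtFinProj.of_sum (σ := σ) (Z := fun _ => total A Θ)
          (fun s => ModuleCat.ofHom (LinearMap.single A Θ (c s) ∘ₗ LinearMap.proj s))
          (fun s => ModuleCat.ofHom (LinearMap.single A (fun s => Θ (c s)) s ∘ₗ
            LinearMap.proj (c s))) ?_ (fun _ => hb)
        refine ModuleCat.hom_ext (LinearMap.ext fun x => ?_)
        rw [ModuleCat.hom_sum, LinearMap.sum_apply]
        simp [Finset.univ_sum_single]
    · intro h0
      refine subsingleton_of_forall_eq 0 fun x => ?_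
      obtain ⟨f, rfl⟩ := (Ext.mk₀_bijective _ _).2 x
      rw [Ext.mk₀_eq_zero_iff]
      exact ModuleCat.hom_ext (LinearMap.ext fun y => by rw [Subsingleton.elim y 0]; simp)
  | succ n ih =>
    -- The first syzygy is again linearly filtered, by the shifted sequence and starting one height
    -- later.
    obtain ⟨ih1, ih2⟩ := ih (i + 1) (fun s => K (s + 1)) (fun s => hK (s + 1)) (fun s => by
      rw [add_assoc, add_comm 1 s]
      exact hgen (s + 1))
    obtain ⟨P, p, hp, ⟨e⟩⟩ := hK 0
    let e' : ModuleCat.of A (LinearMap.ker p) ≅ K 1 := e.symm.toModuleIso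
    have hb1 := bijective_extPrecomp_iso (Θ := Θ) e' n
    have hb2 : Function.Bijective (extPrecomp Θ
        (LinearMap.shortExact_shortComplexKer hp.surjective).extClass n (n + 1) (add_comm 1 n)) := by
      refine bijective_extPrecomp_extClass _ _ ?_
        (subsingleton_ext_of_inAdd (hExt (n + 1) (by omega)) hp.inAdd)
      intro x
      -- For `n = 0` the restriction `Hom(P, Θ) → Hom(Ω, Θ)` is zero because `K 0` is generated in
      -- one height; for larger `n` already `Ext^n(P, Θ) = 0`.
      cases n with
      | zero =>
        obtain ⟨f, rfl⟩ := (Ext.mk₀_bijective _ _).2 x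
        rw [Ext.mk₀_comp_mk₀, Ext.mk₀_eq_zero_iff]
        refine ModuleCat.hom_ext (LinearMap.ext fun y => ?_)
        exact hE.ker_le_ker_of_isRelProjCover hHom hTop hTop' (hgen 0) hp f.hom y.2
      | succ n =>
        have := subsingleton_ext_of_inAdd (hExt (n + 1) (by omega)) hp.inAdd
        rw [Subsingleton.elim (h := this) x 0, Ext.comp_zero]
    refine ⟨(ih1.of_bijective _ _ hb1).of_bijective _ _ hb2, fun hs => ?_⟩
    have := ih2 hs
    have h1 := (Equiv.ofBijective _ hb1).symm.subsingleton
    exact (Equiv.ofBijective _ hb2).symm.subsingleton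

/-- Beyond the largest height there are no factors available, so syzygies eventually vanish. -/
theorem IsGeneratedInHeight.subsingleton {i : ℕ} {M : Type u} [AddCommGroup M] [Module A M]
    (h : IsGeneratedInHeight A Θ i M) (hi : ∀ l : Λ, height l < i) : Subsingleton M := by
  obtain ⟨N, σ, _, c, hc, ⟨L, hL, hN⟩, ⟨e⟩, -⟩ := h.exists_top
  have hL' : L = [] := List.eq_nil_iff_forall_not_mem.2 fun l hl =>
    absurd (hL l hl) (hi l).not_gt
  rw [hL', hasFiltration_nil_iff] at hN
  have : IsEmpty σ := ⟨fun s => (hi (c s)).ne (hc s)⟩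
  have h2 : Subsingleton (M ⧸ N) := e.toEquiv.subsingleton
  have hNtop : N = ⊤ := Submodule.Quotient.subsingleton_iff.1 h2
  exact ((LinearEquiv.ofTop N hNtop).symm.toEquiv).subsingleton

end Vanishing

/-! ### Triangular structure of the extension algebra -/

section ExtAlgebraDiag

open Abelian

theorem of_comp_eq {C : Type*} [Category* C] [Abelian C] [HasExt.{v} C] {X : C} {a b c c' : ℕ}
    (x : Ext X X a) (y : Ext X X b) (h : a + b = c) (h' : a + b = c') :
    DirectSum.of (fun n => Ext X X n) c (x.comp y h) =
      DirectSum.of (fun n => Ext X X n) c' (x.comp y h') := by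
  subst h
  subst h'
  rfl

theorem of_mul_of_eq {C : Type*} [Category* C] [Abelian C] [HasExt.{v} C] {X : C} {a b c : ℕ}
    (x : Ext X X a) (y : Ext X X b) (h : b + a = c) :
    (DirectSum.of (fun n => Ext X X n) a x * DirectSum.of (fun n => Ext X X n) b y : ExtAlgebra X) =
      DirectSum.of (fun n => Ext X X n) c (y.comp x h) := by
  rw [DirectSum.of_mul_of]
  exact of_comp_eq y x (add_comm b a) h

variable {A : Type u} [Ring A] {Λ : Type u} {Θ : Λ → Type u} [∀ l, AddCommGroup (Θ l)]
  [∀ l, Module A (Θ l)]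

variable (A Θ) in
/-- The embedding of `⨁ End(Θ l)` in degree zero of `Ext*(Θ, Θ)`. -/
noncomputable def diagHom : DiagEnd A Θ →+* ExtAlgebra (total A Θ) where
  toFun d := DirectSum.of (fun n => Ext (total A Θ) (total A Θ) n) 0 (diagExt d)
  map_one' := rfl
  map_mul' d d' := by
    rw [of_mul_of_eq _ _ (add_zero 0), Ext.mk₀_comp_mk₀]
    rfl
  map_zero' := by
    change DirectSum.of (fun n => Ext (total A Θ) (total A Θ) n) 0
      (Ext.mk₀ (0 : total A Θ ⟶ total A Θ)) = 0
    rw [Ext.mk₀_zero, map_zero]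
  map_add' d d' := by
    rw [← map_add, ← Ext.mk₀_add]
    rfl

theorem diagHom_apply (d : DiagEnd A Θ) :
    diagHom A Θ d = DirectSum.of (fun n => Ext (total A Θ) (total A Θ) n) 0 (diagExt d) := rfl

theorem diagHom_mul (d : DiagEnd A Θ) (x : ExtAlgebra (total A Θ)) : diagHom A Θ d * x = d • x := by
  induction x using DirectSum.induction_on with
  | zero => rw [mul_zero, smul_zero]
  | of n x =>
    rw [diagHom_apply, of_mul_of_eq _ _ (add_zero n), ← extDiag_smul_def]
    exact (DirectSum.lof (DiagEnd A Θ) ℕ (fun n => Ext (total A Θ) (total A Θ) n) n).map_smul d x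
  | add x y hx hy => rw [mul_add, smul_add, hx, hy]

/-- The action of the diagonal by multiplication in `Γ` coincides with the degreewise
postcomposition action, so the two notions of projectivity agree. -/
theorem projectiveAlong_diagHom_iff : ProjectiveAlong (diagHom A Θ) (ExtAlgebra (total A Θ)) ↔
    Module.Projective (DiagEnd A Θ) (ExtAlgebra (total A Θ)) := by
  have h : Module.compHom (ExtAlgebra (total A Θ)) (diagHom A Θ) =
      (inferInstance : Module (DiagEnd A Θ) (ExtAlgebra (total A Θ))) :=
    Module.ext' _ _ fun d x => diagHom_mul d x
  unfold ProjectiveAlong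
  rw [h]

theorem endIsProjective_iff : EndIsProjective A Θ ↔
    Module.Projective (DiagEnd A Θ) (Ext (total A Θ) (total A Θ) 0) := by
  let : Module (DiagEnd A Θ) (Module.End A (∀ l, Θ l)) :=
    Module.compHom (Module.End A (∀ l, Θ l)) (diagEnd A Θ)
  let f : Module.End A (∀ l, Θ l) →ₗ[DiagEnd A Θ] Ext (total A Θ) (total A Θ) 0 :=
    { toFun := fun g => Ext.mk₀ (ModuleCat.ofHom g)
      map_add' := fun g g' => by rw [← Ext.mk₀_add]; rfl
      map_smul' := fun d g => by
        rw [RingHom.id_apply, extDiag_smul_def, Ext.mk₀_comp_mk₀]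
        rfl }
  have hf : Function.Bijective f := by
    constructor
    · intro g g' h
      have := (Ext.mk₀_bijective _ _).1 h
      exact congrArg ModuleCat.Hom.hom this
    · intro x
      obtain ⟨g, rfl⟩ := (Ext.mk₀_bijective _ _).2 x
      exact ⟨g.hom, rfl⟩
  constructor
  · intro h
    have : Module.Projective (DiagEnd A Θ) (Module.End A (∀ l, Θ l)) := h
    exact Module.Projective.of_equiv (LinearEquiv.ofBijective f hf)
  · intro h
    exact Module.Projective.of_equiv (LinearEquiv.ofBijective f hf).symm

theorem diagEnd_apply (d : DiagEnd A Θ) (x : ∀ l, Θ l) (m : Λ) : diagEnd A Θ d x m = d m (x m) :=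
  rfl

open Classical in
variable (A Θ) in
/-- The diagonal components of the degree zero part of an element of `Ext*(Θ, Θ)`. -/
noncomputable def diagPart : ExtAlgebra (total A Θ) →+ DiagEnd A Θ where
  toFun x l := LinearMap.proj l ∘ₗ (Ext.addEquiv₀ (x 0)).hom ∘ₗ LinearMap.single A Θ l
  map_zero' := by
    ext l
    simp
  map_add' x y := by
    funext l
    rw [DirectSum.add_apply, map_add, ModuleCat.hom_add, LinearMap.add_comp, LinearMap.comp_add]
    rfl

open Classical in
theorem diagPart_of_zero (f : total A Θ ⟶ total A Θ) (l : Λ) :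
    diagPart A Θ (DirectSum.of (fun n => Ext (total A Θ) (total A Θ) n) 0 (Ext.mk₀ f)) l =
      LinearMap.proj l ∘ₗ f.hom ∘ₗ LinearMap.single A Θ l := by
  change LinearMap.proj l ∘ₗ (Ext.addEquiv₀ (DirectSum.of (fun n => Ext (total A Θ) (total A Θ) n) 0
    (Ext.mk₀ f) 0)).hom ∘ₗ LinearMap.single A Θ l = _
  rw [DirectSum.of_eq_same]
  congr 3
  exact Ext.addEquiv₀.apply_symm_apply f

theorem diagPart_of_succ (n : ℕ) (x : Ext (total A Θ) (total A Θ) (n + 1)) :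
    diagPart A Θ (DirectSum.of (fun n => Ext (total A Θ) (total A Θ) n) (n + 1) x) = 0 := by
  funext l
  change LinearMap.proj l ∘ₗ (Ext.addEquiv₀ (DirectSum.of (fun n => Ext (total A Θ) (total A Θ) n)
    (n + 1) x 0)).hom ∘ₗ _ = _
  rw [DirectSum.of_eq_of_ne _ _ _ (by omega)]
  simp

open Classical in
theorem extIdem_eq (l : Λ) : extIdem A Θ l = diagHom A Θ (Pi.single l 1) := by
  rw [extIdem, diagHom_apply]
  congr 3
  refine LinearMap.ext fun x => funext fun m => ?_
  by_cases hm : m = l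
  · subst hm
    simp [diagEnd_apply]
  · simp [diagEnd_apply, Pi.single_eq_of_ne hm]

-- Displays the corner element as factoring through `Extⁿ(Θ l, Θ m)`, so that vanishing of this
-- group annihilates it.
open Classical in
theorem extIdem_mul_of_mul_extIdem (l m : Λ) (n : ℕ) (x : Ext (total A Θ) (total A Θ) n) :
    extIdem A Θ m * DirectSum.of (fun n => Ext (total A Θ) (total A Θ) n) n x * extIdem A Θ l =
      DirectSum.of (fun n => Ext (total A Θ) (total A Θ) n) n
        ((Ext.mk₀ (ModuleCat.ofHom (LinearMap.proj l) : _ ⟶ ModuleCat.of A (Θ l))).comp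
          ((((Ext.mk₀ (ModuleCat.ofHom (LinearMap.single A Θ l))).comp x (zero_add n)).comp
            (Ext.mk₀ (ModuleCat.ofHom (LinearMap.proj m) : _ ⟶ ModuleCat.of A (Θ m)))
              (add_zero n)).comp
            (Ext.mk₀ (ModuleCat.ofHom (LinearMap.single A Θ m))) (add_zero n)) (zero_add n)) := by
  rw [extIdem, extIdem, of_mul_of_eq _ _ (add_zero n), of_mul_of_eq _ _ (zero_add n)]
  congr 1
  rw [ModuleCat.ofHom_comp, ModuleCat.ofHom_comp, ← Ext.mk₀_comp_mk₀, ← Ext.mk₀_comp_mk₀]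
  simp only [Ext.comp_assoc_of_second_deg_zero, Ext.comp_assoc_of_third_deg_zero,
    Ext.mk₀_comp_mk₀]
  exact (Ext.mk₀_comp_mk₀_assoc _ _ _).symm

variable [Fintype Λ] [PartialOrder Λ]

open Classical in
theorem isTriangular_extAlgebra
    (h0 : ∀ n l m, ¬ l ≤ m → Subsingleton (Ext (ModuleCat.of A (Θ l)) (ModuleCat.of A (Θ m)) n))
    (h1 : ∀ n l, Subsingleton (Ext (ModuleCat.of A (Θ l)) (ModuleCat.of A (Θ l)) (n + 1))) :
    IsTriangular (fun l => extIdem A Θ l) (diagHom A Θ) (diagPart A Θ) where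
  idem := extIdem_eq
  left_inv d := by
    funext l
    rw [diagHom_apply, diagPart_of_zero]
    refine LinearMap.ext fun x => ?_
    simp [diagEnd_apply]
  corner l g := by
    induction g using DirectSum.induction_on with
    | zero => simp
    | of n x =>
      cases n with
      | zero =>
        obtain ⟨f, rfl⟩ := (Ext.mk₀_bijective _ _).2 x
        rw [diagPart_of_zero, extIdem_mul_of_mul_extIdem, diagHom_apply, Ext.mk₀_comp_mk₀,
          Ext.mk₀_comp_mk₀, Ext.mk₀_comp_mk₀, Ext.mk₀_comp_mk₀]
        congr 2
        refine ModuleCat.hom_ext (LinearMap.ext fun x => funext fun m => ?_)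
        by_cases hm : m = l
        · subst hm
          simp [diagEnd_apply]
        · simp [diagEnd_apply, Pi.single_eq_of_ne hm]
      | succ n =>
        rw [extIdem_mul_of_mul_extIdem, diagPart_of_succ]
        have := h1 n l
        rw [Subsingleton.elim (h := this) (Ext.comp (Ext.comp _ x _) _ _) 0, Ext.zero_comp,
          Ext.comp_zero]
        simp
    | add x y hx hy =>
      rw [mul_add, add_mul, hx, hy, map_add, Pi.add_apply, Pi.single_add, map_add]
  directed l m hlm g := by
    induction g using DirectSum.induction_on with
    | zero => simp
    | of n x =>
      rw [extIdem_mul_of_mul_extIdem]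
      have := h0 n l m hlm
      rw [Subsingleton.elim (h := this) (Ext.comp (Ext.comp _ x _) _ _) 0, Ext.zero_comp,
        Ext.comp_zero, map_zero]
    | add x y hx hy =>
      rw [mul_add, add_mul, hx, hy, add_zero]

end ExtAlgebraDiag

/-! ### Endomorphism rings of the modules `Θ l` -/

section Endomorphisms

variable {A : Type u} [Ring A]

/-- The images of `f` and `1 - f` span `M`, so by simplicity of the top one of them is onto, hence
bijective since `M` is Noetherian. -/
theorem isLocalRing_end [IsNoetherianRing A] {M : Type*} [AddCommGroup M] [Module A M]
    [Module.Finite A M] [Nontrivial M] (h : IsSimpleModule A (Head A M)) :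
    IsLocalRing (Module.End A M) := by
  have key : ∀ f : Module.End A M, LinearMap.range f = ⊤ → IsUnit f := fun f hf => by
    have hs := LinearMap.range_eq_top.1 hf
    exact (Module.End.isUnit_iff f).2
      ⟨IsNoetherian.injective_of_surjective_endomorphism f hs, hs⟩
  refine IsLocalRing.of_isUnit_or_isUnit_one_sub_self fun f => ?_
  have hsup : LinearMap.range f ⊔ LinearMap.range (1 - f) = ⊤ := by
    refine eq_top_iff.2 fun x _ => Submodule.mem_sup.2 ⟨f x, ⟨x, rfl⟩, (1 - f) x, ⟨x, rfl⟩, ?_⟩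
    simp
  exact (eq_top_or_eq_top_of_sup h hsup).imp (key _) (key _)

theorem finite_end (k : Type v) [Field k] [Algebra k A] [Module.Finite k A] (M : Type*)
    [AddCommGroup M] [Module A M] [Module k M] [IsScalarTower k A M] [Module.Finite A M] :
    Module.Finite k (Module.End A M) := by
  have : Module.Finite k M := Module.Finite.trans A M
  let f : Module.End A M →ₗ[k] Module.End k M :=
    { toFun := fun g => g.restrictScalars k
      map_add' := fun _ _ => rfl
      map_smul' := fun _ _ => rfl }
  have hf : Function.Injective f := fun g g' h => LinearMap.ext fun x => LinearMap.congr_fun h x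
  exact Module.Finite.of_injective f hf

theorem isArtinianRing_end (k : Type v) [Field k] [Algebra k A] [Module.Finite k A] (M : Type*)
    [AddCommGroup M] [Module A M] [Module.Finite A M] : IsArtinianRing (Module.End A M) := by
  let : Module k M := Module.compHom M (algebraMap k A)
  have : IsScalarTower k A M := ⟨fun c a x => by
    rw [Algebra.smul_def, mul_smul]; rfl⟩
  have := finite_end (A := A) k M
  exact IsArtinianRing.of_finite k _

end Endomorphisms

/-! ### Finiteness over `k` -/

section Finiteness

open Abelian

variable {A : Type u} [Ring A] {Λ : Type u} {Θ : Λ → Type u} [∀ l, AddCommGroup (Θ l)]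
  [∀ l, Module A (Θ l)] [Fintype Λ]

/-- Each `Θ l` is finite-dimensional, hence so are `D` and `End(Θ)`. It thus suffices to bound `Γ`
over `D`, the ring over which the dimension shifts are linear. -/
theorem finite_diagEnd_of_finite (k : Type v) [Field k] [Algebra k A] [Module.Finite k A]
    [∀ l, Module.Finite A (Θ l)] :
    Module.Finite (DiagEnd A Θ) (Ext (total A Θ) (total A Θ) 0) ∧
    (Module.Finite (DiagEnd A Θ) (ExtAlgebra (total A Θ)) →
      Module.Finite k (ExtAlgebra (total A Θ))) := by
  let : ∀ l, Module k (Θ l) := fun l => Module.compHom (Θ l) (algebraMap k A)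
  have : ∀ l, IsScalarTower k A (Θ l) := fun l => ⟨fun c a x => by
    rw [Algebra.smul_def, mul_smul]; rfl⟩
  have hfin : ∀ l, Module.Finite k (Module.End A (Θ l)) := fun l => finite_end k (Θ l)
  have hscalar : ∀ (c : k) (d : DiagEnd A Θ), diagExt (c • d) = c • diagExt d := fun c d => by
    rw [← Ext.mk₀_smul]
    rfl
  have htower : ∀ n, IsScalarTower k (DiagEnd A Θ) (Ext (total A Θ) (total A Θ) n) := fun n =>
    ⟨fun c d x => by
      rw [extDiag_smul_def, extDiag_smul_def, hscalar, Ext.comp_smul]⟩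
  constructor
  · have h1 : Module.Finite k (Module.End A (∀ l, Θ l)) := finite_end k _
    have h2 : Module.Finite k (Ext (total A Θ) (total A Θ) 0) := by
      let f : Module.End A (∀ l, Θ l) →ₗ[k] Ext (total A Θ) (total A Θ) 0 :=
        { toFun := fun g => Ext.mk₀ (ModuleCat.ofHom g)
          map_add' := fun g g' => by rw [← Ext.mk₀_add]; rfl
          map_smul' := fun c g => by rw [RingHom.id_apply, ← Ext.mk₀_smul]; rfl }
      refine Module.Finite.of_surjective f fun x => ?_
      obtain ⟨g, rfl⟩ := (Ext.mk₀_bijective _ _).2 x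
      exact ⟨g.hom, rfl⟩
    exact Module.Finite.of_restrictScalars_finite k (DiagEnd A Θ) _
  · intro h
    have : IsScalarTower k (DiagEnd A Θ) (ExtAlgebra (total A Θ)) := ⟨fun c d x => by
      rw [← diagHom_mul, ← diagHom_mul, ← smul_mul_assoc]
      congr 1
      rw [diagHom_apply, diagHom_apply, hscalar]
      exact (DirectSum.lof k ℕ (fun n => Ext (total A Θ) (total A Θ) n) 0).map_smul c _⟩
    exact Module.Finite.trans (DiagEnd A Θ) _

theorem finite_directSum {D : Type*} [Ring D] (M : ℕ → Type*) [∀ n, AddCommGroup (M n)]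
    [∀ n, Module D (M n)] (h : ∀ n, Module.Finite D (M n)) (N : ℕ)
    (hN : ∀ n, N ≤ n → Subsingleton (M n)) : Module.Finite D (DirectSum ℕ M) := by
  let f : (∀ n : Fin N, M n) →ₗ[D] DirectSum ℕ M :=
    ∑ n : Fin N, DirectSum.lof D ℕ M n ∘ₗ LinearMap.proj n
  refine Module.Finite.of_surjective f fun x => ?_
  have hx : x ∈ LinearMap.range f := by
    induction x using DirectSum.induction_on with
    | zero => exact zero_mem _
    | of n x =>
      by_cases hn : n < N
      · refine ⟨Pi.single (⟨n, hn⟩ : Fin N) x, ?_⟩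
        rw [LinearMap.sum_apply, Finset.sum_eq_single (⟨n, hn⟩ : Fin N)]
        · simp [DirectSum.lof_eq_of]
        · intro m _ hm
          simp [Pi.single_eq_of_ne hm]
        · simp
      · have := hN n (not_lt.1 hn)
        rw [Subsingleton.elim x 0, map_zero]
        exact zero_mem _
    | add x y hx hy => exact add_mem hx hy
  exact hx

end Finiteness

end ExtStrat

/-! ### The equivalence -/

open ExtStrat in
theorem corollary2p15 (k : Type v) [Field k] [IsAlgClosed k]
    (A : Type u) [Ring A] [Algebra k A] [Module.Finite k A] (hA : ExtStrat.IsBasic A)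
    (Λ : Type u) [Fintype Λ] [PartialOrder Λ]
    (Θ : Λ → Type u) [∀ l, AddCommGroup (Θ l)] [∀ l, Module A (Θ l)]
    (Q : Λ → Type u) [∀ l, AddCommGroup (Q l)] [∀ l, Module A (Q l)]
    (hE : ExtStrat.IsEPSS A Θ Q)
    (hExt : ∀ s : ℕ, 1 ≤ s →
      Subsingleton (Abelian.Ext (ModuleCat.of A (∀ l, Q l)) (ModuleCat.of A (∀ l, Θ l)) s))
    (hTop : ∀ l, IsSimpleModule A (ExtStrat.Head A (Θ l)))
    (hTop' : ∀ l m, l ≠ m →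
      IsEmpty (ExtStrat.Head A (Θ l) ≃ₗ[A] ExtStrat.Head A (Θ m)))
    (hLin : ∀ l, ExtStrat.IsLinearlyFiltered A Θ Q (Θ l))
    (hHom : Nonempty (((∀ l, Q l) →ₗ[A] (∀ l, Θ l)) ≃ₗ[Module.End A (∀ l, Θ l)]
      ((∀ l, Θ l) →ₗ[A] (∀ l, Θ l)))) :
    ExtStrat.IsStandardlyStratified k (R := ExtStrat.ExtAlgebra (ModuleCat.of A (∀ l, Θ l)))
      (fun l => ExtStrat.extIdem A Θ l) ↔
    ExtStrat.EndIsProjective A Θ := by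
  classical
  have hNoeth : IsNoetherianRing A := isNoetherian_of_tower k inferInstance
  have hfin := hE.finite_Θ
  have hnt := hE.nontrivial_Θ
  have hloc : ∀ l, IsLocalRing (Module.End A (Θ l)) := fun l => isLocalRing_end (hTop l)
  have hart : ∀ l, IsArtinianRing (Module.End A (Θ l)) := fun l => isArtinianRing_end k (Θ l)
  have hart' : IsArtinianRing (Module.End A (∀ l, Θ l)) := isArtinianRing_end k _
  have hnil : ∀ l, ∃ n : ℕ, (⊥ : Ideal (Module.End A (Θ l))).jacobson ^ n = ⊥ := fun l =>
    IsArtinianRing.isNilpotent_jacobson_bot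
  have hdir := hE.subsingleton_ext hExt
  have T := isTriangular_extAlgebra (A := A) (Θ := Θ) (fun n => (hdir n).1)
    (fun n l => (hdir n).2 l l (lt_irrefl l))
  rw [endIsProjective_iff]
  constructor
  · intro h
    have hP := projectiveAlong_diagHom_iff.1 (T.projectiveAlong_of_isStandardlyStratified k h)
    -- `End(Θ)` is the degree zero direct summand of the `D`-projective module `Γ`.
    exact Module.Projective.of_split
      (DirectSum.lof (DiagEnd A Θ) ℕ
        (fun n => Abelian.Ext (total A Θ) (total A Θ) n) 0)
      (DirectSum.component (DiagEnd A Θ) ℕ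
        (fun n => Abelian.Ext (total A Θ) (total A Θ) n) 0)
      (LinearMap.ext fun x => DirectSum.component.lof_self (DiagEnd A Θ) 0 x)
  · intro h
    obtain ⟨hfin0, hfink⟩ := finite_diagEnd_of_finite (A := A) (Θ := Θ) k
    -- `B` exceeds every height, so for `n ≥ B` the `n`-th syzygy, generated in height `i + n`, is
    -- zero. This makes `Γ` finitely generated over `D`.
    obtain ⟨B, hB⟩ : ∃ B : ℕ, ∀ l : Λ, height l < B :=
      ⟨Finset.univ.sup (fun l : Λ => height l) + 1, fun l =>
        Nat.lt_succ_of_le (Finset.le_sup (f := fun l : Λ => height l) (Finset.mem_univ l))⟩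
    have hΘ : ∀ l n, IsExtFinProj Θ (ModuleCat.of A (Θ l)) n ∧
        (B ≤ n → Subsingleton (Abelian.Ext (ModuleCat.of A (Θ l)) (total A Θ) n)) := by
      intro l n
      obtain ⟨-, i, K, ⟨e⟩, hK, hgen⟩ := hLin l
      obtain ⟨h1, h2⟩ := hE.isExtFinProj_syzygy hExt hTop hTop' hHom ⟨hfin0, h⟩ n i K hK hgen
      have hbij := bijective_extPrecomp_iso (Θ := Θ)
        (e.symm.toModuleIso : ModuleCat.of A (Θ l) ≅ K 0) n
      refine ⟨h1.of_bijective _ _ hbij, fun hn => ?_⟩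
      have hs := h2 ((hgen n).subsingleton fun l => (hB l).trans_le (by omega))
      exact (Equiv.ofBijective _ hbij).symm.subsingleton
    have hsum : ∑ l, (ModuleCat.ofHom (LinearMap.proj l) : total A Θ ⟶ ModuleCat.of A (Θ l)) ≫
        (ModuleCat.ofHom (LinearMap.single A Θ l) : ModuleCat.of A (Θ l) ⟶ total A Θ) =
          𝟙 (total A Θ) := by
      refine ModuleCat.hom_ext (LinearMap.ext fun x => ?_)
      rw [ModuleCat.hom_sum, LinearMap.sum_apply]
      simp [Finset.univ_sum_single]
    have hFP : ∀ n, IsExtFinProj Θ (total A Θ) n := fun n =>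
      IsExtFinProj.of_sum _ _ hsum fun l => (hΘ l n).1
    have hproj : ∀ n, Module.Projective (DiagEnd A Θ)
        (Abelian.Ext (total A Θ) (total A Θ) n) := fun n => (hFP n).2
    have hfinΓ := hfink (finite_directSum _ (fun n => (hFP n).1) B fun n hn =>
      subsingleton_ext_of_sum _ _ hsum fun l => (hΘ l n).2 hn)
    exact T.isStandardlyStratified hnil k (projectiveAlong_diagHom_iff.2 inferInstance)
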